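/- Let $p$ be a prime, $G$ a finite group and ${\bf C}=(C_1,\dots,C_4)$ four conjugacy classes of $G$ consisting of elements of order prime to $p$. *Notation.* For a finite group $X$, let $X_1\to X$ be the maximal Frattini cover of $X$ whose kernel is an elementary abelian $p$-group. The characteristic $p$-Frattini tower of $X$ is $G_0(X)=X$, $G_{k+1}(X)=(G_k(X))_1$; write $G_k=G_k(G)$. Let $R_X=X_1/[M,X_1]\to X$, $M=\ker(X_1\to X)$; its kernel is the maximal quotient of $M$ on which $X$ acts trivially. If $X$ is $p$-perfect (no quotient of order $p$), let $R_{X,p}\to X$ be the universal central extension of $X$ with $p$-group kernel. For a central extension $R\to X$ with $p$-group kernel and elements $x_1,\dots,x_r\in X$ of order prime to $p$, put $s_R(x_1,\dots,x_r)=\hat x_1\cdots\hat x_r$, where $\hat x_i\in R$ is the unique lift of $x_i$ of order prime to $p$; put $s_{X,p}=s_{R_{X,p}}$. A class $C$ of $X$ of elements of order prime to $p$ is identified with the unique class of such elements above it in $G_k(X)$. The Nielsen class ${\rm Ni}(G_k(X),(C_1,\dots,C_r))$ is the set of $r$-tuples generating $G_k(X)$, with product $1$ and with entries in $C_1,\dots,C_r$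 in some order. Its braid orbits are the orbits under simultaneous conjugation and the braids $(\dots,a,b,\dots)\mapsto(\dots,aba^{-1},a,\dots)$. An infinite component branch of the modular tower of $(X,(C_i),p)$ over a braid orbit $O$ is a sequence of braid orbits $O_k\subset{\rm Ni}(G_k(X),(C_i))$, $k\ge 0$, with $O_0=O$ and $O_{k+1}$ mapping to $O_k$. The cusp of a $4$-tuple is its orbit under simultaneous conjugation and $q_2$, $(q_1q_2q_3)^2$, $q_1q_3^{-1}$, where $q_i$ is the braid at places $i,i+1$; an infinite cusp branch is a sequence of cusps in the ${\rm Ni}(G_k,{\bf C})$, $k\ge0$, each mapping to the preceding one. For ${\bf g}=(g_1,g_2,g_3,g_4)$ set $H_{2,3}({\bf g})=\langle g_2,g_3\rangle$, $H_{1,4}({\bf g})=\langle g_1,g_4\rangle$, ${\bf g}'=(g_2,g_3,(g_2g_3)^{-1})$ and ${\bf g}''=((g_4g_1)^{-1},g_4,g_1)$. Call ${\bf g}$ an o-$p'$ cusp if $p\nmid{\rm ord}(g_2g_3)$ and $H_{2,3}({\bf g})$, $H_{1,4}({\bf g})$ are not both of order prime to $p$. *Claims.* 1. Let ${\bf g}\in{\rm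 Ni}(G,{\bf C})$ be an o-$p'$ cusp, $H_{2,3}=H_{2,3}({\bf g})$, $H_{1,4}=H_{1,4}({\bf g})$. Then $G$, $H_{2,3}$, $H_{1,4}$ are $p$-perfect and, with $\beta_{i,j}:R_{H_{i,j},p}\to R_{G,p}$ the unique homomorphism over the inclusion $H_{i,j}\le G$, $$s_{G,p}({\bf g})=\beta_{1,4}\bigl(s_{H_{1,4},p}({\bf g}'')\bigr)\,\beta_{2,3}\bigl(s_{H_{2,3},p}({\bf g}')\bigr).$$ 2. Let $k\ge 0$ and let ${\bf g}\in{\rm Ni}(G_k,{\bf C})$ be an o-$p'$ cusp; put $H_{2,3}=H_{2,3}({\bf g})\le G_k$, $H_{1,4}=H_{1,4}({\bf g})\le G_k$. If $s_{R_{H_{2,3}}}({\bf g}')=1$ and $s_{R_{H_{1,4}}}({\bf g}'')=1$, then there is an o-$p'$ cusp in ${\rm Ni}(G_{k+1},{\bf C})$ mapping to ${\bf g}$. 3. Let ${\bf g}\in{\rm Ni}(G,{\bf C})$ be an o-$p'$ cusp, and let ${\bf C}_{2,3}$, ${\bf C}_{1,4}$ be the triples of conjugacy classes in $H_{2,3}({\bf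 g})$, $H_{1,4}({\bf g})$ of the entries of ${\bf g}'$, ${\bf g}''$. Suppose the modular tower of $(H_{2,3}({\bf g}),{\bf C}_{2,3},p)$ has an infinite component branch over the braid orbit of ${\bf g}'$, and that of $(H_{1,4}({\bf g}),{\bf C}_{1,4},p)$ has one over the braid orbit of ${\bf g}''$. Then there are o-$p'$ cusps ${}_k{\bf g}\in{\rm Ni}(G_k,{\bf C})$, $k\ge 0$, with ${}_0{\bf g}={\bf g}$ and each ${}_{k+1}{\bf g}$ mapping to ${}_k{\bf g}$; their cusps form an infinite cusp branch and their braid orbits an infinite component branch over the braid orbit of ${\bf g}$. -/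

import Mathlib

universe u

namespace ModularTower

/-- An epimorphism of groups is a Frattini cover if proper subgroups have proper images. -/
def IsFrattini {E G : Type*} [Group E] [Group G] (φ : E →* G) : Prop :=
  Function.Surjective φ ∧ ∀ T : Subgroup E, T.map φ = ⊤ → T = ⊤

/-- The kernel is an elementary abelian `p`-group. -/
def HasElementaryKernel (p : ℕ) {E G : Type*} [Group E] [Group G] (φ : E →* G) : Prop :=
  (∀ x ∈ φ.ker, x ^ p = 1) ∧ ∀ x ∈ φ.ker, ∀ y ∈ φ.ker, x * y = y * x

/-- `φ` is an epimorphism with central kernel, and the kernel is a `p`-group. -/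
def IsCentralPExtension (p : ℕ) {E G : Type*} [Group E] [Group G] (φ : E →* G) : Prop :=
  Function.Surjective φ ∧ φ.ker ≤ Subgroup.center E ∧ IsPGroup p φ.ker

/-- A group is `p`-perfect if it has no quotient of order `p`. -/
def IsPPerfect (p : ℕ) (G : Type*) [Group G] : Prop :=
  ∀ N : Subgroup G, N.Normal → N.index ≠ p

/-- A finite group together with a homomorphism to `G`. -/
structure FiniteCover (G : Type u) [Group G] where
  /-- the covering group -/
  carrier : Type u
  [group : Group carrier]
  [finite : Finite carrier]
  /-- the map to the base -/
  proj : carrier →* G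

attribute [instance] FiniteCover.group FiniteCover.finite

instance (G : Type u) [Group G] : CoeSort (FiniteCover G) (Type u) := ⟨FiniteCover.carrier⟩

theorem exists_frattini_subgroup {E G : Type*} [Group E] [Finite E] [Group G] (φ : E →* G)
    (hφ : Function.Surjective φ) :
    ∃ S : Subgroup E, IsFrattini (φ.comp S.subtype) := by
  obtain ⟨S, hS⟩ := Set.Finite.exists_minimal (s := {S : Subgroup E | S.map φ = ⊤})
    (Set.toFinite _) ⟨⊤, by simpa [← MonoidHom.range_eq_map, MonoidHom.range_eq_top] using hφ⟩
  refine ⟨S, ?_, ?_⟩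
  · intro g
    have : g ∈ S.map φ := by rw [hS.1]; trivial
    obtain ⟨x, hx, rfl⟩ := this
    exact ⟨⟨x, hx⟩, rfl⟩
  · intro T hT
    have h1 : (T.map S.subtype).map φ = ⊤ := by rw [Subgroup.map_map]; exact hT
    have h2 : S ≤ T.map S.subtype := hS.2 h1 (Subgroup.map_subtype_le T)
    rw [eq_top_iff]
    rintro ⟨x, hx⟩ -
    obtain ⟨y, hy, hyx⟩ := h2 hx
    have : y = ⟨x, hx⟩ := Subtype.ext hyx
    exact this ▸ hy

/-- `φ` is the maximal Frattini cover of `G` with elementary abelian `p`-group kernel: any other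
such cover is a quotient of it. -/
def IsMaxElementaryFrattini (p : ℕ) {E G : Type u} [Group E] [Group G] (φ : E →* G) : Prop :=
  IsFrattini φ ∧ HasElementaryKernel p φ ∧
    ∀ (E' : Type u) [Group E'] [Finite E'] (φ' : E' →* G),
      IsFrattini φ' → HasElementaryKernel p φ' → ∃ f : E →* E', φ'.comp f = φ

theorem exists_isMaxElementaryFrattini (p : ℕ) [hp : Fact p.Prime] (G : Type u) [Group G]
    [Finite G] : ∃ X : FiniteCover G, IsMaxElementaryFrattini p X.proj := by
  let π : FreeGroup G →* G := FreeGroup.lift id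
  have hπ : Function.Surjective π := fun g => ⟨FreeGroup.of g, by simp [π]⟩
  let L : Subgroup (FreeGroup G) := Subgroup.normalClosure
    ({z | ∃ x ∈ π.ker, z = x ^ p} ∪ {z | ∃ x ∈ π.ker, ∃ y ∈ π.ker, z = x * y * x⁻¹ * y⁻¹})
  have hL : L ≤ π.ker := by
    refine Subgroup.normalClosure_le_normal ?_
    rintro z (⟨x, hx, rfl⟩ | ⟨x, hx, y, hy, rfl⟩)
    · exact pow_mem hx p
    · exact mul_mem (mul_mem (mul_mem hx hy) (inv_mem hx)) (inv_mem hy)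
  let φ : FreeGroup G ⧸ L →* G := QuotientGroup.lift L π hL
  have hφ : Function.Surjective φ := fun g => by
    obtain ⟨x, hx⟩ := hπ g
    exact ⟨QuotientGroup.mk x, hx⟩
  have hk : HasElementaryKernel p φ := by
    constructor
    · intro x hx
      obtain ⟨x, rfl⟩ := QuotientGroup.mk_surjective x
      rw [← QuotientGroup.mk_pow, QuotientGroup.eq_one_iff]
      exact Subgroup.subset_normalClosure (Or.inl ⟨x, hx, rfl⟩)
    · intro x hx y hy
      obtain ⟨x, rfl⟩ := QuotientGroup.mk_surjective x
      obtain ⟨y, rfl⟩ := QuotientGroup.mk_surjective y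
      rw [← mul_inv_eq_one, mul_inv_rev, ← mul_assoc]
      refine (QuotientGroup.eq_one_iff (N := L) (x * y * x⁻¹ * y⁻¹)).2 ?_
      exact Subgroup.subset_normalClosure (Or.inr ⟨x, hx, y, hy, rfl⟩)
  have hfq : Finite ((FreeGroup G ⧸ L) ⧸ φ.ker) :=
    Finite.of_equiv _ (QuotientGroup.quotientKerEquivOfSurjective φ hφ).symm.toEquiv
  have hfi : φ.ker.FiniteIndex := Subgroup.finiteIndex_iff_finite_quotient.2 hfq
  have hfk : Finite φ.ker := by
    let _ : CommGroup φ.ker :=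
      { (inferInstance : Group φ.ker) with
        mul_comm := fun x y => Subtype.ext (hk.2 x x.2 y y.2) }
    have : Group.FG φ.ker := inferInstance
    refine CommGroup.finite_of_fg_isMulTorsion φ.ker fun x => ?_
    exact isOfFinOrder_iff_pow_eq_one.2 ⟨p, hp.1.pos, Subtype.ext (hk.1 x x.2)⟩
  have hfin : Finite (FreeGroup G ⧸ L) := Finite.of_subgroup_quotient φ.ker
  obtain ⟨S, hS⟩ := exists_frattini_subgroup φ hφ
  refine ⟨⟨S, φ.comp S.subtype⟩, hS, ⟨?_, ?_⟩, ?_⟩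
  · intro x hx
    exact Subtype.ext (hk.1 x hx)
  · intro x hx y hy
    exact Subtype.ext (hk.2 x hx y hy)
  · intro E' _ _ φ' h1 h2
    let s : G → E' := Function.surjInv h1.1
    let f : FreeGroup G →* E' := FreeGroup.lift s
    have hf : φ'.comp f = π := by
      ext g
      simp [f, s, π, Function.surjInv_eq h1.1]
    have hfm : ∀ x ∈ π.ker, f x ∈ φ'.ker := fun x hx => by
      rw [MonoidHom.mem_ker, ← MonoidHom.comp_apply, hf]; exact hx
    have hLf : L ≤ f.ker := by
      refine Subgroup.normalClosure_le_normal ?_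
      rintro z (⟨x, hx, rfl⟩ | ⟨x, hx, y, hy, rfl⟩)
      · simp only [SetLike.mem_coe, MonoidHom.mem_ker, map_pow]
        exact h2.1 _ (hfm x hx)
      · simp only [SetLike.mem_coe, MonoidHom.mem_ker, map_mul, map_inv]
        rw [h2.2 _ (hfm x hx) _ (hfm y hy)]
        group
    refine ⟨(QuotientGroup.lift L f hLf).comp S.subtype, ?_⟩
    ext x
    obtain ⟨y, hy⟩ := QuotientGroup.mk_surjective x.1
    simp only [MonoidHom.comp_apply, Subgroup.subtype_apply, ← hy]
    exact DFunLike.congr_fun hf y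

/-- The representation cover of `(G, p)`: the universal central extension of `G` with `p`-group
kernel. -/
def IsRepresentationCover (p : ℕ) {R G : Type u} [Group R] [Group G] (ψ : R →* G) : Prop :=
  IsFrattini ψ ∧ IsCentralPExtension p ψ ∧
    ∀ (E : Type u) [Group E] [Finite E] (φ : E →* G),
      IsCentralPExtension p φ → ∃! f : R →* E, φ.comp f = ψ

theorem IsPPerfect.hom_eq_one {p : ℕ} [hp : Fact p.Prime] {E A : Type*} [Group E] [Group A]
    [Finite A] (hE : IsPPerfect p E) (hA : IsPGroup p A) (hc : ∀ x y : A, x * y = y * x)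
    (f : E →* A) : f = 1 := by
  by_contra hne
  have hQ : IsPGroup p f.range := hA.to_subgroup _
  obtain ⟨n, hn⟩ := IsPGroup.iff_card.1 hQ
  have hn0 : n ≠ 0 := by
    rintro rfl
    rw [pow_zero, Subgroup.card_eq_one] at hn
    exact hne (MonoidHom.range_eq_bot_iff.1 hn)
  obtain ⟨m, rfl⟩ := Nat.exists_eq_succ_of_ne_zero hn0
  obtain ⟨K, hK⟩ := Sylow.exists_subgroup_card_pow_prime (G := f.range) p (n := m)
    (by rw [hn]; exact pow_dvd_pow p (Nat.le_succ m))
  have hKn : K.Normal := ⟨fun x hx y => by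
    have : y * x * y⁻¹ = x := by
      apply Subtype.ext
      have := hc y x
      simp [this]
    rwa [this]⟩
  have hi : K.index = p := by
    have h := K.card_mul_index
    rw [hK, hn, pow_succ] at h
    exact Nat.eq_of_mul_eq_mul_left (pow_pos hp.1.pos m) h
  refine hE (K.comap f.rangeRestrict) inferInstance ?_
  rw [Subgroup.index_comap_of_surjective _ f.rangeRestrict_surjective, hi]

theorem IsPPerfect.of_frattini {p : ℕ} [hp : Fact p.Prime] {E G : Type*} [Group E] [Group G]
    {φ : E →* G} (hφ : IsFrattini φ) (hG : IsPPerfect p G) : IsPPerfect p E := by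
  intro N hN hi
  have hne : N.map φ ≠ ⊤ := fun h => by
    rw [hφ.2 N h, Subgroup.index_top] at hi
    exact hp.1.one_lt.ne hi
  have hd : (N.map φ).index ∣ p := by
    rw [← hi]; exact Subgroup.index_map_dvd N hφ.1
  rcases (Nat.dvd_prime hp.1).1 hd with h | h
  · exact hne (Subgroup.index_eq_one.1 h)
  · exact hG _ (Subgroup.Normal.map hN φ hφ.1) h

theorem not_dvd_card_abelianization {p : ℕ} [hp : Fact p.Prime] {E : Type*} [Group E] [Finite E]
    (hE : IsPPerfect p E) : ¬ p ∣ Nat.card (Abelianization E) := by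
  intro hd
  have hsurj : Function.Surjective (Abelianization.of (G := E)) := QuotientGroup.mk_surjective
  have hfin : Finite (Abelianization E) := Finite.of_surjective _ hsurj
  let P : Abelianization E →* Abelianization E := powMonoidHom p
  have hQ : IsPGroup p (Abelianization E ⧸ P.range) := by
    intro x
    obtain ⟨x, rfl⟩ := QuotientGroup.mk_surjective x
    exact ⟨1, by rw [pow_one, ← QuotientGroup.mk_pow, QuotientGroup.eq_one_iff]; exact ⟨x, rfl⟩⟩
  have h1 := hE.hom_eq_one hQ (fun x y => mul_comm x y)
    ((QuotientGroup.mk' P.range).comp Abelianization.of)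
  have hs : Function.Surjective P := by
    intro y
    obtain ⟨x, rfl⟩ := hsurj y
    have := DFunLike.congr_fun h1 x
    exact (QuotientGroup.eq_one_iff (N := P.range) _).1 this
  have hinj : Function.Injective P := Finite.injective_iff_surjective.2 hs
  obtain ⟨x, hx⟩ := exists_prime_orderOf_dvd_card' p hd
  have : x = 1 := hinj (by
    change x ^ p = 1 ^ p
    rw [one_pow, ← hx, pow_orderOf_eq_one])
  rw [this, orderOf_one] at hx
  exact hp.1.one_lt.ne hx

theorem ker_le_commutator {p : ℕ} [hp : Fact p.Prime] {E G : Type*} [Group E] [Finite E]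
    [Group G] {φ : E →* G} (hE : IsPPerfect p E) (hφ : IsPGroup p φ.ker) :
    φ.ker ≤ commutator E := by
  intro x hx
  obtain ⟨k, hk⟩ := hφ ⟨x, hx⟩
  have hk' : x ^ p ^ k = 1 := congrArg Subtype.val hk
  have hsurj : Function.Surjective (Abelianization.of (G := E)) := QuotientGroup.mk_surjective
  have hfin : Finite (Abelianization E) := Finite.of_surjective _ hsurj
  have h1 : (Abelianization.of x) ^ p ^ k = 1 := by rw [← map_pow, hk', map_one]
  have h2 : orderOf (Abelianization.of x) = 1 := by
    refine Nat.eq_one_of_dvd_coprimes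
      (((Nat.Prime.coprime_iff_not_dvd hp.1).2 (not_dvd_card_abelianization hE)).pow_left k)
      (orderOf_dvd_of_pow_eq_one h1) (orderOf_dvd_natCard _)
  rw [orderOf_eq_one_iff] at h2
  rwa [← MonoidHom.mem_ker, Abelianization.ker_of] at h2

theorem card_le_of_central {p : ℕ} [hp : Fact p.Prime] (G : Type u) [Group G] [Finite G]
    (hG : IsPPerfect p G) :
    ∃ B : ℕ, ∀ X : FiniteCover G, IsFrattini X.proj → IsCentralPExtension p X.proj →
      Nat.card X ≤ B := by
  refine ⟨((Finset.range (Nat.card (G × G) + 1)).sup Subgroup.cardCommutatorBound) * Nat.card G,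
    fun X h1 h2 => ?_⟩
  have h3 : X.proj.ker ≤ commutator X :=
    ker_le_commutator (IsPPerfect.of_frattini h1 hG) h2.2.2
  let s : G → X := Function.surjInv h1.1
  have hs : ∀ x : X, ∃ z ∈ Subgroup.center X, x = s (X.proj x) * z := fun x => by
    refine ⟨(s (X.proj x))⁻¹ * x, h2.2.1 ?_, by group⟩
    rw [MonoidHom.mem_ker, map_mul, map_inv, Function.surjInv_eq h1.1, inv_mul_cancel]
  have h4 : Nat.card (commutatorSet X) ≤ Nat.card (G × G) := by
    refine Nat.card_le_card_of_surjective
      (fun q : G × G => (⟨_, commutator_mem_commutatorSet (s q.1) (s q.2)⟩ : commutatorSet X)) ?_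
    rintro ⟨_, x, y, rfl⟩
    refine ⟨(X.proj x, X.proj y), Subtype.ext ?_⟩
    obtain ⟨a, ha, hx⟩ := hs x
    obtain ⟨b, hb, hy⟩ := hs y
    rw [Subgroup.mem_center_iff] at ha hb
    change s (X.proj x) * s (X.proj y) * (s (X.proj x))⁻¹ * (s (X.proj y))⁻¹
      = x * y * x⁻¹ * y⁻¹
    conv_rhs => rw [hx, hy]
    generalize s (X.proj x) = x'
    generalize s (X.proj y) = y'
    rw [mul_inv_rev, mul_inv_rev]
    have e1 : x' * a * (y' * b) * (a⁻¹ * x'⁻¹) * (b⁻¹ * y'⁻¹)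
        = x' * (a * (y' * b)) * (a⁻¹ * x'⁻¹) * (b⁻¹ * y'⁻¹) := by group
    rw [e1, ← ha]
    have e2 : x' * (y' * b * a) * (a⁻¹ * x'⁻¹) * (b⁻¹ * y'⁻¹)
        = x' * y' * (b * x'⁻¹) * (b⁻¹ * y'⁻¹) := by group
    rw [e2, ← hb]
    group
  have h5 := Subgroup.card_commutator_le_of_finite_commutatorSet (G := X)
  have h6 : Nat.card X.proj.ker ≤ (Finset.range (Nat.card (G × G) + 1)).sup
      Subgroup.cardCommutatorBound :=
    ((Subgroup.card_le_of_le h3).trans h5).trans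
      (Finset.le_sup (f := Subgroup.cardCommutatorBound) (Finset.mem_range.2 (by omega)))
  have h7 : Nat.card X = Nat.card X.proj.ker * Nat.card G := by
    rw [← X.proj.ker.card_mul_index, Subgroup.index_ker,
      MonoidHom.range_eq_top.2 h1.1, Subgroup.card_top]
  rw [h7]
  exact Nat.mul_le_mul_right _ h6

theorem exists_isRepresentationCover (p : ℕ) [hp : Fact p.Prime] (G : Type u) [Group G]
    [Finite G] (hG : IsPPerfect p G) :
    ∃ X : FiniteCover G, IsRepresentationCover p X.proj := by
  obtain ⟨B, hB⟩ := card_le_of_central G hG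
  let D : Set ℕ := {n | ∃ X : FiniteCover G, IsFrattini X.proj ∧ IsCentralPExtension p X.proj ∧
    Nat.card X = n}
  have hDne : D.Nonempty := by
    refine ⟨_, ⟨G, MonoidHom.id G⟩, ⟨Function.surjective_id, fun T hT => by simpa using hT⟩,
      ⟨Function.surjective_id, ?_, ?_⟩, rfl⟩
    · change (MonoidHom.id G).ker ≤ _
      simp
    · rintro ⟨x, hx⟩
      exact ⟨0, Subtype.ext (by rw [pow_zero, pow_one]; simpa using hx)⟩
  have hDb : BddAbove D := ⟨B, by rintro _ ⟨X, h1, h2, rfl⟩; exact hB X h1 h2⟩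
  obtain ⟨X, h1, h2, h3⟩ := Nat.sSup_mem hDne hDb
  refine ⟨X, h1, h2, fun E _ _ φ hφ => ?_⟩
  have hex : ∃ f : X →* E, φ.comp f = X.proj := by
    let P : Subgroup (X × E) :=
      (X.proj.comp (MonoidHom.fst X E)).eqLocus (φ.comp (MonoidHom.snd X E))
    let ρ : P →* G := (X.proj.comp (MonoidHom.fst X E)).comp P.subtype
    have hρ : Function.Surjective ρ := fun g => by
      obtain ⟨x, hx⟩ := h1.1 g
      obtain ⟨y, hy⟩ := hφ.1 g
      exact ⟨⟨(x, y), by change X.proj x = φ y; rw [hx, hy]⟩, hx⟩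
    obtain ⟨S, hS⟩ := exists_frattini_subgroup ρ hρ
    let Y : FiniteCover G := ⟨S, ρ.comp S.subtype⟩
    have hmem : ∀ z : S, z ∈ (ρ.comp S.subtype).ker →
        z.1.1.1 ∈ X.proj.ker ∧ z.1.1.2 ∈ φ.ker := fun z hz => by
      have h : X.proj z.1.1.1 = 1 := hz
      have h' : X.proj z.1.1.1 = φ z.1.1.2 := z.1.2
      exact ⟨h, by rw [MonoidHom.mem_ker, ← h', h]⟩
    have hY : IsCentralPExtension p Y.proj := by
      refine ⟨hS.1, fun z hz => ?_, fun z => ?_⟩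
      · obtain ⟨ha, hb⟩ := hmem z hz
        have ha := Subgroup.mem_center_iff.1 (h2.2.1 ha)
        have hb := Subgroup.mem_center_iff.1 (hφ.2.1 hb)
        refine Subgroup.mem_center_iff.2 fun w => ?_
        exact Subtype.ext (Subtype.ext (Prod.ext (ha _) (hb _)))
      · obtain ⟨ha, hb⟩ := hmem z.1 z.2
        obtain ⟨k, hk⟩ := h2.2.2 ⟨_, ha⟩
        obtain ⟨l, hl⟩ := hφ.2.2 ⟨_, hb⟩
        have hk : z.1.1.1.1 ^ p ^ k = 1 := congrArg Subtype.val hk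
        have hl : z.1.1.1.2 ^ p ^ l = 1 := congrArg Subtype.val hl
        refine ⟨k + l, Subtype.ext (Subtype.ext (Subtype.ext (Prod.ext ?_ ?_)))⟩
        · change z.1.1.1.1 ^ p ^ (k + l) = 1
          rw [pow_add, pow_mul, hk, one_pow]
        · change z.1.1.1.2 ^ p ^ (k + l) = 1
          rw [pow_add, mul_comm, pow_mul, hl, one_pow]
    have hle : Nat.card S ≤ Nat.card X := by
      rw [h3]
      exact le_csSup hDb ⟨Y, hS, hY, rfl⟩
    let q : S →* X := (MonoidHom.fst X E).comp (P.subtype.comp S.subtype)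
    have hqs : Function.Surjective q := by
      rw [← MonoidHom.range_eq_top]
      refine h1.2 _ (eq_top_iff.2 fun g _ => ?_)
      obtain ⟨z, hz⟩ := hS.1 g
      exact ⟨q z, ⟨z, rfl⟩, hz⟩
    have hqb : Function.Bijective q :=
      hqs.bijective_of_nat_card_le hle
    let e : S ≃* X := MulEquiv.ofBijective q hqb
    refine ⟨((MonoidHom.snd X E).comp (P.subtype.comp S.subtype)).comp e.symm.toMonoidHom, ?_⟩
    ext x
    obtain ⟨z, rfl⟩ := e.surjective x
    have h' : X.proj z.1.1.1 = φ z.1.1.2 := z.1.2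
    simp only [MonoidHom.comp_apply, MulEquiv.coe_toMonoidHom, MulEquiv.symm_apply_apply]
    exact h'.symm
  obtain ⟨f, hf⟩ := hex
  refine ⟨f, hf, fun f' hf' => ?_⟩
  have hmem : ∀ x, f' x * (f x)⁻¹ ∈ φ.ker := fun x => by
    have e1 := DFunLike.congr_fun hf x
    have e2 := DFunLike.congr_fun hf' x
    simp only [MonoidHom.comp_apply] at e1 e2
    rw [MonoidHom.mem_ker, map_mul, map_inv, e1, e2, mul_inv_cancel]
  have hcen : ∀ x y, y * (f' x * (f x)⁻¹) = f' x * (f x)⁻¹ * y := fun x y =>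
    Subgroup.mem_center_iff.1 (hφ.2.1 (hmem x)) y
  let d : X →* φ.ker :=
    { toFun := fun x => ⟨f' x * (f x)⁻¹, hmem x⟩
      map_one' := Subtype.ext (by simp)
      map_mul' := fun x y => Subtype.ext (by
        simp only [map_mul, mul_inv_rev, Subgroup.coe_mul]
        have := hcen y (f x)⁻¹
        calc f' x * f' y * ((f y)⁻¹ * (f x)⁻¹) = f' x * (f' y * (f y)⁻¹ * (f x)⁻¹) := by group
          _ = _ := by rw [← this]; group) }
  have hd := (IsPPerfect.of_frattini h1 hG).hom_eq_one hφ.2.2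
    (fun x y => Subtype.ext (Subgroup.mem_center_iff.1 (hφ.2.1 y.2) x)) d
  ext x
  have : f' x * (f x)⁻¹ = 1 := congrArg Subtype.val (DFunLike.congr_fun hd x)
  exact mul_inv_eq_one.1 this


/-! ### The characteristic tower and the two Schur-multiplier extensions -/

/-- The maximal Frattini cover of `G` with elementary abelian `p`-group kernel (unique up to
isomorphism over `G`). -/
noncomputable def maxCover (p : ℕ) [Fact p.Prime] (G : Type u) [Group G] [Finite G] :
    FiniteCover G :=
  (exists_isMaxElementaryFrattini p G).choose

theorem maxCover_spec (p : ℕ) [Fact p.Prime] (G : Type u) [Group G] [Finite G] :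
    IsMaxElementaryFrattini p (maxCover p G).proj :=
  (exists_isMaxElementaryFrattini p G).choose_spec

/-- The characteristic `p`-Frattini tower `G_0 = G, G_1, G_2, …`, each group with its map to `G`:
`G_{k+1}` is the maximal Frattini cover of `G_k` with elementary abelian `p`-group kernel. -/
noncomputable def tower (p : ℕ) [Fact p.Prime] (G : Type u) [Group G] [Finite G] :
    ℕ → FiniteCover G
  | 0 => ⟨G, MonoidHom.id G⟩
  | k + 1 => ⟨maxCover p (tower p G k), (tower p G k).proj.comp (maxCover p (tower p G k)).proj⟩

/-- The map `G_{k+1} → G_k`. -/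
noncomputable def step (p : ℕ) [Fact p.Prime] (G : Type u) [Group G] [Finite G] (k : ℕ) :
    tower p G (k + 1) →* tower p G k :=
  (maxCover p (tower p G k)).proj

/-- The extension `R_G → G` whose kernel is the maximal quotient of `M = ker (G_1 → G)` on which
`G` acts trivially: `R_G = G_1 / [M, G_1]`. -/
noncomputable def headCover (p : ℕ) [Fact p.Prime] (G : Type u) [Group G] [Finite G] :
    FiniteCover G where
  carrier := maxCover p G ⧸ ⁅(maxCover p G).proj.ker, (⊤ : Subgroup (maxCover p G))⁆
  proj := QuotientGroup.lift _ (maxCover p G).proj (Subgroup.commutator_le_left _ _)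

/-- The representation cover `R_{G,p} → G` of a `p`-perfect group: the universal central
`p`-extension, whose kernel is the `p`-part of the Schur multiplier. -/
noncomputable def repCover (p : ℕ) [Fact p.Prime] (G : Type u) [Group G] [Finite G]
    (hG : IsPPerfect p G) : FiniteCover G :=
  (exists_isRepresentationCover p G hG).choose

theorem repCover_spec (p : ℕ) [Fact p.Prime] (G : Type u) [Group G] [Finite G]
    (hG : IsPPerfect p G) : IsRepresentationCover p (repCover p G hG).proj :=
  (exists_isRepresentationCover p G hG).choose_spec

theorem existsUnique_repCoverMap (p : ℕ) [Fact p.Prime] {G : Type u} [Group G] [Finite G]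
    (H : Subgroup G) (hH : IsPPerfect p H) (hG : IsPPerfect p G) :
    ∃! β : repCover p H hH →* repCover p G hG,
      (repCover p G hG).proj.comp β = H.subtype.comp (repCover p H hH).proj := by
  obtain ⟨h1, h2, -⟩ := repCover_spec p G hG
  have hc : IsCentralPExtension p ((repCover p G hG).proj.subgroupComap H) := by
    have hmem : ∀ z ∈ ((repCover p G hG).proj.subgroupComap H).ker,
        z.1 ∈ (repCover p G hG).proj.ker := fun z hz => congrArg Subtype.val hz
    refine ⟨?_, fun z hz => ?_, fun z => ?_⟩
    · rintro ⟨x, hx⟩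
      obtain ⟨y, rfl⟩ := h1.1 x
      exact ⟨⟨y, hx⟩, rfl⟩
    · exact Subgroup.mem_center_iff.2 fun w =>
        Subtype.ext (Subgroup.mem_center_iff.1 (h2.2.1 (hmem z hz)) w.1)
    · obtain ⟨k, hk⟩ := h2.2.2 ⟨_, hmem z.1 z.2⟩
      have hk : z.1.1 ^ p ^ k = 1 := congrArg Subtype.val hk
      exact ⟨k, Subtype.ext (Subtype.ext hk)⟩
  obtain ⟨f, hf, hu⟩ := (repCover_spec p H hH).2.2 _ _ hc
  refine ⟨(Subgroup.subtype _).comp f, ?_, fun β hβ => ?_⟩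
  · ext x
    exact congrArg Subtype.val (DFunLike.congr_fun hf x)
  · have hm : ∀ x, β x ∈ H.comap (repCover p G hG).proj := fun x => by
      have := DFunLike.congr_fun hβ x
      simp only [MonoidHom.comp_apply] at this
      rw [Subgroup.mem_comap, this]
      exact ((repCover p H hH).proj x).2
    have := hu (β.codRestrict _ hm) (MonoidHom.ext fun x =>
      Subtype.ext (DFunLike.congr_fun hβ x))
    rw [← this]
    rfl

/-- The unique homomorphism `β_H : R_{H,p} → R_{G,p}` over the inclusion `H ≤ G`. -/
noncomputable def repCoverMap (p : ℕ) [Fact p.Prime] {G : Type u} [Group G] [Finite G]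
    (H : Subgroup G) (hH : IsPPerfect p H) (hG : IsPPerfect p G) :
    repCover p H hH →* repCover p G hG :=
  (existsUnique_repCoverMap p H hH hG).choose

/-! ### Lifting invariants -/

/-- An element of order prime to `p` lifts uniquely to an element of order prime to `p` along a
central extension by a finite `p`-group. -/
theorem existsUnique_lift {p : ℕ} [hp : Fact p.Prime] {R G : Type*} [Group R] [Finite R]
    [Group G] {ψ : R →* G} (hψ : IsCentralPExtension p ψ) {g : G} (hg : ¬ p ∣ orderOf g) :
    ∃! x : R, ψ x = g ∧ ¬ p ∣ orderOf x := by
  have hcp : ∀ n : ℕ, ¬ p ∣ n → ∀ k, Nat.Coprime (p ^ k) n := fun n hn k =>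
    ((Nat.Prime.coprime_iff_not_dvd hp.1).2 hn).pow_left k
  obtain ⟨y, rfl⟩ := hψ.1 g
  obtain ⟨k, m, hm, hkm⟩ := Nat.exists_eq_pow_mul_and_not_dvd (orderOf_pos y).ne' p hp.1.ne_one
  refine existsUnique_of_exists_of_unique ?_ ?_
  · obtain ⟨b, hb⟩ := exists_pow_eq_self_of_coprime (hcp _ hg k)
    refine ⟨(y ^ p ^ k) ^ b, by rw [map_pow, map_pow, hb], fun h => hm ?_⟩
    refine (h.trans (orderOf_pow_dvd b)).trans (orderOf_dvd_of_pow_eq_one ?_)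
    rw [← pow_mul, ← hkm, pow_orderOf_eq_one]
  · rintro x x' ⟨h1, h2⟩ ⟨h3, h4⟩
    have hz : x⁻¹ * x' ∈ ψ.ker := by rw [MonoidHom.mem_ker, map_mul, map_inv, h1, h3,
      inv_mul_cancel]
    have hc := Subgroup.mem_center_iff.1 (hψ.2.1 hz)
    obtain ⟨l, hl⟩ := hψ.2.2 ⟨_, hz⟩
    have hl : (x⁻¹ * x') ^ p ^ l = 1 := congrArg Subtype.val hl
    have hcomm : Commute x⁻¹ x' := by
      have h : x * x' = x' * x := by
        calc x * x' = x * (x * (x⁻¹ * x')) := by group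
          _ = x * (x⁻¹ * x' * x) := by rw [hc x]
          _ = x' * x := by group
      exact Commute.inv_left h
    have h5 : (x⁻¹ * x') ^ (orderOf x * orderOf x') = 1 := by
      rw [hcomm.mul_pow, inv_pow, pow_mul, pow_orderOf_eq_one, one_pow, mul_comm, pow_mul,
        pow_orderOf_eq_one, one_pow]
      simp
    have h6 : orderOf (x⁻¹ * x') = 1 :=
      Nat.eq_one_of_dvd_coprimes (hcp _ (fun h => (hp.1.dvd_mul.1 h).elim h2 h4) l)
        (orderOf_dvd_of_pow_eq_one hl) (orderOf_dvd_of_pow_eq_one h5)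
    exact inv_mul_eq_one.1 (orderOf_eq_one_iff.1 h6)

open Classical in
/-- The lift of `g` to an element of order prime to `p` (junk if there is none). -/
noncomputable def coprimeLift (p : ℕ) {R G : Type*} [Group R] [Group G] (ψ : R →* G) (g : G) : R :=
  if h : ∃ x : R, ψ x = g ∧ ¬ p ∣ orderOf x then h.choose else 1

/-- The small lifting invariant: the ordered product of the lifts, of orders prime to `p`, of the
entries of `g`. -/
noncomputable def liftingInvariant (p : ℕ) {R G : Type*} [Group R] [Group G] (ψ : R →* G) {r : ℕ}
    (g : Fin r → G) : R :=
  (List.ofFn fun i => coprimeLift p ψ (g i)).prod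

/-! ### Nielsen classes, braids, cusps -/

/-- The Nielsen class of `(E, C)`, where `π : E → G` has `p`-group kernel and `C` is a tuple of
classes of `G` of elements of order prime to `p`: generating product-one tuples whose entries lie,
in some order, in the classes `C`. Here `C i` is also regarded as a class of `E`, namely the
unique class of elements of order prime to `p` above it. -/
def nielsenClass (p : ℕ) {E G : Type*} [Group E] [Group G] (π : E →* G) {r : ℕ}
    (C : Fin r → ConjClasses G) : Set (Fin r → E) :=
  {g | (∃ σ : Equiv.Perm (Fin r), ∀ i, ConjClasses.mk (π (g (σ i))) = C i) ∧
    (∀ i, ¬ p ∣ orderOf (g i)) ∧ Subgroup.closure (Set.range g) = ⊤ ∧ (List.ofFn g).prod = 1}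

/-- The elementary braid replacing the consecutive entries `a, b` in places `i, i + 1` by
`a b a⁻¹, a`. -/
def braid {E : Type*} [Group E] {n : ℕ} (i : Fin n) (g : Fin (n + 1) → E) : Fin (n + 1) → E :=
  fun j =>
    if j = i.castSucc then g i.castSucc * g i.succ * (g i.castSucc)⁻¹
    else if j = i.succ then g i.castSucc
    else g j

/-- Simultaneous conjugation of the entries. -/
def conjTuple {E : Type*} [Group E] {r : ℕ} (c : E) (g : Fin r → E) : Fin r → E :=
  fun j => c * g j * c⁻¹

/-- One step of braid equivalence on inner classes. -/
def BraidStep {E : Type*} [Group E] {n : ℕ} (g g' : Fin (n + 1) → E) : Prop :=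
  (∃ i : Fin n, g' = braid i g) ∨ ∃ c : E, g' = conjTuple c g

/-- The braid orbit of `g` (on inner classes, as a set of tuples). -/
def braidOrbit {E : Type*} [Group E] {n : ℕ} (g : Fin (n + 1) → E) : Set (Fin (n + 1) → E) :=
  {g' | Relation.EqvGen BraidStep g g'}

/-- One step of cusp equivalence on inner classes of 4-tuples: the action of `q_2`, of
`(q_1 q_2 q_3)²`, or of `q_1 q_3⁻¹`, or a conjugation. Braids act on the right. -/
def CuspStep {E : Type*} [Group E] (g g' : Fin 4 → E) : Prop :=
  g' = braid (1 : Fin 3) g ∨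
  g' = braid (2 : Fin 3) (braid (1 : Fin 3) (braid (0 : Fin 3)
    (braid (2 : Fin 3) (braid (1 : Fin 3) (braid (0 : Fin 3) g))))) ∨
  braid (2 : Fin 3) g' = braid (0 : Fin 3) g ∨
  ∃ c : E, g' = conjTuple c g

/-- The cusp of `g`: its orbit under the cusp group `⟨q_2, (q_1 q_2 q_3)², q_1 q_3⁻¹⟩` on inner
classes, as a set of tuples. -/
def cuspSet {E : Type*} [Group E] (g : Fin 4 → E) : Set (Fin 4 → E) :=
  {g' | Relation.EqvGen CuspStep g g'}

/-! For a 4-tuple `(g_1, g_2, g_3, g_4)` the entries are `g 0, g 1, g 2, g 3`. -/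

/-- `H_{2,3} = ⟨g_2, g_3⟩`. -/
def H23 {E : Type*} [Group E] (g : Fin 4 → E) : Subgroup E := Subgroup.closure {g 1, g 2}

/-- `H_{1,4} = ⟨g_1, g_4⟩`. -/
def H14 {E : Type*} [Group E] (g : Fin 4 → E) : Subgroup E := Subgroup.closure {g 0, g 3}

/-- The triple `(g_2, g_3, (g_2 g_3)⁻¹)` in `H_{2,3}`. -/
def triple23 {E : Type*} [Group E] (g : Fin 4 → E) : Fin 3 → H23 g :=
  let a : H23 g := ⟨g 1, Subgroup.subset_closure (by simp)⟩
  let b : H23 g := ⟨g 2, Subgroup.subset_closure (by simp)⟩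
  ![a, b, (a * b)⁻¹]

/-- The triple `((g_4 g_1)⁻¹, g_4, g_1)` in `H_{1,4}`. -/
def triple14 {E : Type*} [Group E] (g : Fin 4 → E) : Fin 3 → H14 g :=
  let a : H14 g := ⟨g 0, Subgroup.subset_closure (by simp)⟩
  let d : H14 g := ⟨g 3, Subgroup.subset_closure (by simp)⟩
  ![(d * a)⁻¹, d, a]

/-- The conjugacy classes of the entries of a tuple. -/
def classesOf {E : Type*} [Group E] {r : ℕ} (g : Fin r → E) : Fin r → ConjClasses E :=
  fun i => ConjClasses.mk (g i)

/-- No element of the subgroup has order divisible by `p`. -/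
def IsPrimeToP (p : ℕ) {E : Type*} [Group E] (H : Subgroup E) : Prop :=
  ∀ x ∈ H, ¬ p ∣ orderOf x

/-- `g` represents a cusp of type "group prime to `p`". -/
def IsGroupCusp (p : ℕ) {E : Type*} [Group E] (g : Fin 4 → E) : Prop :=
  IsPrimeToP p (H23 g) ∧ IsPrimeToP p (H14 g)

/-- `g` represents a cusp of type "only prime to `p`": the middle product has order prime to `p`,
but the subgroups `H_{2,3}` and `H_{1,4}` do not both have order prime to `p`. -/
def IsOnlyCusp (p : ℕ) {E : Type*} [Group E] (g : Fin 4 → E) : Prop :=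
  ¬ p ∣ orderOf (g 1 * g 2) ∧ ¬ IsGroupCusp p g

/-! ### Branches -/

/-- An infinite component branch of the modular tower of `(G, C, p)`: braid orbits
`O k` in the Nielsen classes of `(G_k, C)`, each mapping to the preceding one. -/
def IsComponentBranch (p : ℕ) [Fact p.Prime] {G : Type u} [Group G] [Finite G] {n : ℕ}
    (C : Fin (n + 1) → ConjClasses G) (O : ∀ k, Set (Fin (n + 1) → tower p G k)) : Prop :=
  (∀ k, ∃ g ∈ nielsenClass p (tower p G k).proj C, O k = braidOrbit g) ∧
    ∀ k, Set.MapsTo (fun g i => step p G k (g i)) (O (k + 1)) (O k)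

/-- The branch starts at the braid orbit of the tuple `g` of elements of `G`. -/
def StartsAt (p : ℕ) [Fact p.Prime] {G : Type u} [Group G] [Finite G] {n : ℕ}
    (O : ∀ k, Set (Fin (n + 1) → tower p G k)) (g : Fin (n + 1) → G) : Prop :=
  (fun (h : Fin (n + 1) → tower p G 0) i => (tower p G 0).proj (h i)) '' O 0 = braidOrbit g

/-- An infinite cusp branch of the modular tower of `(G, C, p)`. -/
def IsCuspBranch (p : ℕ) [Fact p.Prime] {G : Type u} [Group G] [Finite G]
    (C : Fin 4 → ConjClasses G) (B : ∀ k, Set (Fin 4 → tower p G k)) : Prop :=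
  (∀ k, ∃ g ∈ nielsenClass p (tower p G k).proj C, B k = cuspSet g) ∧
    ∀ k, Set.MapsTo (fun g i => step p G k (g i)) (B (k + 1)) (B k)

end ModularTower

open ModularTower

/-!
The product formula rests on the identity `(g₂ g₃)⁻¹ = g₄ g₁`. Lifts of order prime to `p` are
unique in a central extension with `p`-group kernel, so the maps between representation covers
respect them (`repCoverMap_coprimeLift`), and the two lifts of `g₂ g₃` that occur in the
invariants of the triples cancel. What remains is `ĝ₂ ĝ₃ ĝ₄ ĝ₁`, which is the lifting invariant of
`g` up to conjugation by `ĝ₁`, hence equal to it, being central.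

For the lifting statements, let `φ : E → H` be an extension with elementary abelian `p`-group
kernel `M`. Two facts carry the argument. Lifts of order prime to `p` of a given element exist and
are conjugate under `M` (`exists_coprime_lift`, `exists_conj_eq`). And if `x`, `y` generate `E`
modulo `M`, then the products of an `M`-conjugate of `x` with one of `y` fill the coset
`[M, E] x y` (`exists_conj_mul_conj_eq`), so that the only obstruction to lifting the product-one triple
`(a, b, (a b)⁻¹)` lives in the central extension `E / [M, E]` of `H`. The head cover of `H` maps
to this extension, by the maximality of the elementary Frattini cover, and therefore a trivial
lifting invariant in the head cover suffices (`HasCoprimeLift.of_headCover`).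

Thus the hypotheses on the two triples of an o-`p'` cusp provide lifts `x`, `y` of `g₂`, `g₃` and
`d`, `a` of `g₄`, `g₁`, of orders prime to `p` like their products `x y` and `d a`. Both `d a` and
`(x y)⁻¹` lift `g₄ g₁`, so some `u` in the kernel conjugates the first to the second, and
`(u a u⁻¹, x, y, u d u⁻¹)` has product one. It generates because the cover is Frattini.

Infinite branches are handled in the same way at all levels at once. A component branch of a
triple contains a compatible sequence of triples (`exists_sequence_of_isComponentBranch`); the
inclusion of the subgroup in `G` extends to the towers (`exists_tower_hom`) and carries this
sequence into the tower of `G`; and the conjugating elements are chosen compatibly, level by level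
(`exists_conj_lift`, `exists_tower_of_hasTowerLift`).
-/

namespace ModularTower

/-! ### Elements of order prime to `p` -/

section Coprime

variable {p : ℕ} {E H : Type*} [Group E] [Group H]

theorem not_dvd_orderOf_map (f : E →* H) {x : E} (hx : ¬ p ∣ orderOf x) : ¬ p ∣ orderOf (f x) :=
  fun h => hx (h.trans (orderOf_map_dvd f x))

theorem not_dvd_orderOf_inv {x : E} (hx : ¬ p ∣ orderOf x) : ¬ p ∣ orderOf x⁻¹ := by
  rwa [orderOf_inv]

theorem orderOf_conj (c x : E) : orderOf (c * x * c⁻¹) = orderOf x :=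
  orderOf_injective (MulAut.conj c).toMonoidHom (MulAut.conj c).injective x

/-- Existence of a lift of order prime to `p` along an epimorphism of finite groups; there is no
condition on the kernel. -/
theorem exists_coprime_lift [hp : Fact p.Prime] [Finite E] {φ : E →* H}
    (hφ : Function.Surjective φ) {g : H} (hg : ¬ p ∣ orderOf g) :
    ∃ x : E, φ x = g ∧ ¬ p ∣ orderOf x := by
  obtain ⟨y, rfl⟩ := hφ g
  obtain ⟨k, m, hm, hkm⟩ := Nat.exists_eq_pow_mul_and_not_dvd (orderOf_pos y).ne' p hp.1.ne_one
  obtain ⟨b, hb⟩ := exists_pow_eq_self_of_coprime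
    (((Nat.Prime.coprime_iff_not_dvd hp.1).2 hg).pow_left k)
  refine ⟨(y ^ p ^ k) ^ b, by rw [map_pow, map_pow, hb], fun h => hm ?_⟩
  refine (h.trans (orderOf_pow_dvd b)).trans (orderOf_dvd_of_pow_eq_one ?_)
  rw [← pow_mul, ← hkm, pow_orderOf_eq_one]

theorem coprimeLift_spec {φ : E →* H} {g : H} (h : ∃ x : E, φ x = g ∧ ¬ p ∣ orderOf x) :
    φ (coprimeLift p φ g) = g ∧ ¬ p ∣ orderOf (coprimeLift p φ g) := by
  rw [coprimeLift, dif_pos h]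
  exact h.choose_spec

theorem coprimeLift_eq [Fact p.Prime] [Finite E] {φ : E →* H} (hφ : IsCentralPExtension p φ) {x : E}
    (hx : ¬ p ∣ orderOf x) : coprimeLift p φ (φ x) = x :=
  (existsUnique_lift hφ (not_dvd_orderOf_map φ hx)).unique (coprimeLift_spec ⟨x, rfl, hx⟩)
    ⟨rfl, hx⟩

/-- A group generated by elements of order prime to `p` is `p`-perfect: these elements are
trivial in every quotient of order `p`. -/
theorem isPPerfect_of_closure [hp : Fact p.Prime] {S : Set E} (hS : Subgroup.closure S = ⊤)
    (h : ∀ s ∈ S, ¬ p ∣ orderOf s) : IsPPerfect p E := by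
  intro N hN hi
  have hle : Subgroup.closure S ≤ N := (Subgroup.closure_le N).2 fun s hs => by
    have h1 : (QuotientGroup.mk' N s) ^ p = 1 := by
      rw [← map_pow, ← MonoidHom.mem_ker, QuotientGroup.ker_mk', ← hi]
      exact N.pow_index_mem s
    have h2 : orderOf (QuotientGroup.mk' N s) = 1 :=
      ((Nat.dvd_prime hp.1).1 (orderOf_dvd_of_pow_eq_one h1)).resolve_right fun h3 =>
        not_dvd_orderOf_map (QuotientGroup.mk' N) (h s hs) h3.symm.dvd
    rwa [orderOf_eq_one_iff, ← MonoidHom.mem_ker, QuotientGroup.ker_mk'] at h2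
  rw [hS, top_le_iff] at hle
  rw [hle, Subgroup.index_top] at hi
  exact hp.1.one_lt.ne hi

/-- Two lifts of order prime to `p` of the same element along an extension with elementary
abelian `p`-group kernel `M` are conjugate under `M` (the vanishing of `H¹` of a cyclic group of
order prime to `p` with values in `M`). -/
theorem exists_conj_eq [hp : Fact p.Prime] {φ : E →* H} (hφ : HasElementaryKernel p φ) {x y : E}
    (hx : ¬ p ∣ orderOf x) (hy : ¬ p ∣ orderOf y) (hxy : φ x = φ y) :
    ∃ u ∈ φ.ker, u * x * u⁻¹ = y := by
  let _ : CommGroup φ.ker :=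
    { (inferInstance : Group φ.ker) with
      mul_comm := fun a b => Subtype.ext (hφ.2 a a.2 b b.2) }
  let n := orderOf x * orderOf y
  have hn : Nat.Coprime n p :=
    ((Nat.Prime.coprime_iff_not_dvd hp.1).2 fun h => (hp.1.dvd_mul.1 h).elim hx hy).symm
  -- The cocycle `i ↦ y ^ i * x ^ (-i)`, of period `n`; a power of its product over a period
  -- conjugates `x` to `y`, the exponent `t` being such that `c 1 ^ (n * t) = c 1`.
  let c : ℕ → φ.ker := fun i => ⟨y ^ i * (x ^ i)⁻¹, by
    rw [MonoidHom.mem_ker, map_mul, map_inv, map_pow, map_pow, hxy, mul_inv_cancel]⟩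
  let σ : φ.ker →* φ.ker := (MulAut.conjNormal x : MulAut φ.ker).toMonoidHom
  have hσ : ∀ m : φ.ker, (σ m : E) = x * m * x⁻¹ := fun m => MulAut.conjNormal_apply x m
  have hc : ∀ i, c (i + 1) = c 1 * σ (c i) := fun i => Subtype.ext (by
    rw [Subgroup.coe_mul, hσ]
    simp only [c, pow_succ', pow_zero]
    group)
  have hc0 : c n = c 0 := Subtype.ext (by
    have h1 : y ^ n = 1 := orderOf_dvd_iff_pow_eq_one.1 (Dvd.intro_left _ rfl)
    have h2 : x ^ n = 1 := orderOf_dvd_iff_pow_eq_one.1 (Dvd.intro _ rfl)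
    simp only [c, h1, h2, pow_zero])
  have hprod : ∏ i ∈ Finset.range n, c i = c 1 ^ n * σ (∏ i ∈ Finset.range n, c i) := by
    have h1 : ∏ i ∈ Finset.range n, c (i + 1) = ∏ i ∈ Finset.range n, c i := by
      have h := Finset.prod_range_succ' c n
      rw [Finset.prod_range_succ, hc0] at h
      exact (mul_right_cancel h).symm
    conv_lhs => rw [← h1]
    rw [Finset.prod_congr rfl fun i _ => hc i, Finset.prod_mul_distrib, Finset.prod_const,
      Finset.card_range, ← map_prod]
  obtain ⟨t, ht⟩ := exists_pow_eq_self_of_coprime (x := c 1) (n := n)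
    (hn.coprime_dvd_right (orderOf_dvd_of_pow_eq_one (Subtype.ext (hφ.1 _ (c 1).2))))
  let v := (∏ i ∈ Finset.range n, c i) ^ t
  have hv : v = c 1 * σ v := by
    change (∏ i ∈ Finset.range n, c i) ^ t = c 1 * σ ((∏ i ∈ Finset.range n, c i) ^ t)
    conv_lhs => rw [hprod]
    rw [mul_pow, ht, map_pow]
  refine ⟨v, v.2, ?_⟩
  have hv' : (v : E) = y * x⁻¹ * (x * v * x⁻¹) := by
    rw [← hσ]
    have := congrArg Subtype.val hv
    rw [Subgroup.coe_mul] at this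
    simpa [c] using this
  calc (v : E) * x * (v : E)⁻¹ = y * x⁻¹ * (x * v * x⁻¹) * x * (v : E)⁻¹ := by rw [← hv']
    _ = y := by group

end Coprime

/-! ### Maximality of elementary Frattini covers -/

section Cover

variable {p : ℕ}

/-- The maximal elementary Frattini cover maps over the base to every extension with elementary
abelian `p`-group kernel, Frattini or not: such an extension contains a Frattini cover. -/
theorem exists_hom_of_hasElementaryKernel {H X E : Type u} [Group H] [Group X] [Group E]
    [Finite E] {ψ : X →* H} (hψ : IsMaxElementaryFrattini p ψ) {φ : E →* H}
    (hs : Function.Surjective φ) (hφ : HasElementaryKernel p φ) :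
    ∃ f : X →* E, φ.comp f = ψ := by
  obtain ⟨S, hS⟩ := exists_frattini_subgroup φ hs
  obtain ⟨f, hf⟩ := hψ.2.2 S (φ.comp S.subtype) hS
    ⟨fun x hx => Subtype.ext (hφ.1 x hx), fun x hx y hy => Subtype.ext (hφ.2 x hx y hy)⟩
  exact ⟨S.subtype.comp f, by rw [← MonoidHom.comp_assoc, hf]⟩

/-- The pullback form of maximality: a homomorphism `μ : H → G` of the bases extends to a
homomorphism from the maximal elementary Frattini cover of `H` to any extension of `G` with
elementary abelian `p`-group kernel. -/
theorem exists_hom_lift {H X E G : Type u} [Group H] [Finite H] [Group X] [Group E] [Group G]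
    [Finite E] {ψ : X →* H} (hψ : IsMaxElementaryFrattini p ψ) {φ : E →* G}
    (hs : Function.Surjective φ) (hφ : HasElementaryKernel p φ) (μ : H →* G) :
    ∃ f : X →* E, φ.comp f = μ.comp ψ := by
  -- `P` is the fibre product of `H` and `E` over `G`.
  let P : Subgroup (H × E) := (μ.comp (MonoidHom.fst H E)).eqLocus (φ.comp (MonoidHom.snd H E))
  have hker : ∀ z : P, z.1.1 = 1 → z.1.2 ∈ φ.ker := fun z hz => by
    have h : μ z.1.1 = φ z.1.2 := z.2
    rw [MonoidHom.mem_ker, ← h, hz, map_one]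
  obtain ⟨f, hf⟩ := exists_hom_of_hasElementaryKernel hψ
    (φ := (MonoidHom.fst H E).comp P.subtype)
    (fun h => by
      obtain ⟨e, he⟩ := hs (μ h)
      exact ⟨⟨(h, e), he.symm⟩, rfl⟩)
    ⟨fun z hz => Subtype.ext (Prod.ext
        (by change z.1.1 ^ p = 1; rw [show z.1.1 = 1 from hz, one_pow])
        (hφ.1 _ (hker z hz))),
      fun z hz w hw => Subtype.ext (Prod.ext
        (by change z.1.1 * w.1.1 = w.1.1 * z.1.1
            rw [show z.1.1 = 1 from hz, show w.1.1 = 1 from hw])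
        (hφ.2 _ (hker z hz) _ (hker w hw)))⟩
  refine ⟨(MonoidHom.snd H E).comp (P.subtype.comp f), MonoidHom.ext fun x => ?_⟩
  have h1 : (f x).1.1 = ψ x := DFunLike.congr_fun hf x
  have h2 : μ (f x).1.1 = φ (f x).1.2 := (f x).2
  rw [h1] at h2
  exact h2.symm

end Cover

/-! ### Lifting product-one triples through a head cover -/

section Triple

variable {p : ℕ}

/-- The elements `a`, `b` lift along `φ` to elements of order prime to `p` whose product has order
prime to `p`: equivalently, the product-one triple `(a, b, (a * b)⁻¹)` lifts to a product-one
triple of elements of order prime to `p`. -/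
def HasCoprimeLift (p : ℕ) {E H : Type*} [Group E] [Group H] (φ : E →* H) (a b : H) : Prop :=
  ∃ x y : E, φ x = a ∧ φ y = b ∧ ¬ p ∣ orderOf x ∧ ¬ p ∣ orderOf y ∧ ¬ p ∣ orderOf (x * y)

/-- If `M` is an abelian normal subgroup and `x`, `y` generate the group modulo `M`, the products
of an `M`-conjugate of `x` and an `M`-conjugate of `y` fill the coset `[M, E] x y`. -/
theorem exists_conj_mul_conj_eq {E : Type*} [Group E] {M : Subgroup E} [hM : M.Normal]
    (hc : ∀ a ∈ M, ∀ b ∈ M, a * b = b * a) {x y : E}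
    (hxy : M ⊔ Subgroup.closure {x, y} = ⊤) {n : E} (hn : n ∈ ⁅M, (⊤ : Subgroup E)⁆) :
    ∃ u ∈ M, ∃ v ∈ M, (u * x * u⁻¹) * (v * y * v⁻¹) = n * (x * y) := by
  let _ : CommGroup M :=
    { (inferInstance : Group M) with mul_comm := fun a b => Subtype.ext (hc a a.2 b b.2) }
  let γ : E → M →* M := fun e => MonoidHom.id M / (MulAut.conjNormal e : MulAut M).toMonoidHom
  have hγ : ∀ e (m : M), (γ e m : E) = m * e * (m : E)⁻¹ * e⁻¹ := fun e m => by
    change ((m / MulAut.conjNormal e m : M) : E) = _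
    rw [Subgroup.coe_div, MulAut.conjNormal_apply, div_eq_mul_inv]
    group
  have hmul : ∀ e f m, γ (e * f) m = γ e m * (γ f m * γ e (γ f m)⁻¹) := fun e f m =>
    Subtype.ext (by simp only [hγ, Subgroup.coe_mul, Subgroup.coe_inv]; group)
  -- `K` consists of the products `[m₁, x] [m₂, x y]` with `m₁`, `m₂` in `M`.
  let K : Subgroup M := (γ x).range ⊔ (γ (x * y)).range
  let T : Subgroup E :=
    { carrier := {e | ∀ m, γ e m ∈ K}
      mul_mem' := fun {e f} he hf m => by
        rw [hmul]
        exact mul_mem (he _) (mul_mem (hf _) (he _))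
      one_mem' := fun m => by
        have : γ 1 m = 1 := Subtype.ext (by rw [hγ, Subgroup.coe_one]; group)
        rw [this]
        exact one_mem K
      inv_mem' := fun {e} he m => by
        have : γ e⁻¹ m = (γ e (MulAut.conjNormal e⁻¹ m))⁻¹ := Subtype.ext (by
          simp only [hγ, Subgroup.coe_inv, MulAut.conjNormal_apply]
          group)
        rw [this]
        exact inv_mem (he _) }
  have hxT : x ∈ T := fun m => Subgroup.mem_sup_left ⟨m, rfl⟩
  have hxyT : x * y ∈ T := fun m => Subgroup.mem_sup_right ⟨m, rfl⟩
  have hT : T = ⊤ := by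
    rw [eq_top_iff, ← hxy]
    refine sup_le (fun e he m => ?_) ((Subgroup.closure_le T).2 ?_)
    · have : γ e m = 1 := Subtype.ext (by rw [hγ, hc m m.2 e he, Subgroup.coe_one]; group)
      rw [this]
      exact one_mem K
    · rintro _ (rfl | rfl)
      · exact hxT
      · have := T.mul_mem (T.inv_mem hxT) hxyT
        rwa [inv_mul_cancel_left] at this
  have hle : ⁅M, (⊤ : Subgroup E)⁆ ≤ K.map M.subtype := by
    refine Subgroup.commutator_le.2 fun m hm e _ => ?_
    have he : e ∈ T := by rw [hT]; trivial
    exact ⟨γ e ⟨m, hm⟩, he ⟨m, hm⟩, by rw [Subgroup.subtype_apply, hγ, commutatorElement_def]⟩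
  obtain ⟨k, hk, rfl⟩ := hle hn
  obtain ⟨_, ⟨m₁, rfl⟩, _, ⟨m₂, rfl⟩, rfl⟩ := Subgroup.mem_sup.1 hk
  -- Conjugate `x` by `m₁`, and then both entries by `m₂`.
  refine ⟨m₂ * m₁, mul_mem m₂.2 m₁.2, m₂, m₂.2, ?_⟩
  rw [mul_comm (γ x m₁)]
  have h := congrArg Subtype.val (mul_comm (γ (x * y) m₂) (γ x m₁))
  have h2 := congrArg Subtype.val (mul_comm m₂ (γ x m₁))
  simp only [Subgroup.subtype_apply]
  rw [h]
  simp only [Subgroup.coe_mul] at h2 ⊢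
  calc (m₂ * m₁ : E) * x * (m₂ * m₁ : E)⁻¹ * (m₂ * y * (m₂ : E)⁻¹)
      = (m₂ * (γ x m₁ : E)) * (x * y * (m₂ : E)⁻¹) := by rw [hγ]; group
    _ = _ := by rw [h2, hγ (x * y)]; group

/-- The head cover has the same obstruction to lifting triples as any other extension `φ` with
elementary abelian `p`-group kernel `M`: it maps to the central extension obtained from `φ` by
dividing out `[M, E]`, and the lifts of a generating triple in `E`, each of which may be
conjugated by `M`, have as products a full coset of `[M, E]`. -/
theorem HasCoprimeLift.of_headCover [Fact p.Prime] {H E : Type u} [Group H] [Finite H] [Group E]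
    [Finite E] {φ : E →* H} (hs : Function.Surjective φ) (hφ : HasElementaryKernel p φ) {a b : H}
    (hab : Subgroup.closure {a, b} = ⊤) (h : HasCoprimeLift p (headCover p H).proj a b) :
    HasCoprimeLift p φ a b := by
  let L : Subgroup E := ⁅φ.ker, (⊤ : Subgroup E)⁆
  have hL : L ≤ φ.ker := Subgroup.commutator_le_left _ _
  let φ' : E ⧸ L →* H := QuotientGroup.lift L φ hL
  have hφ's : Function.Surjective φ' := fun g => by
    obtain ⟨x, hx⟩ := hs g
    exact ⟨QuotientGroup.mk x, hx⟩
  have hφ' : HasElementaryKernel p φ' := by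
    constructor
    · intro x hx
      obtain ⟨x, rfl⟩ := QuotientGroup.mk_surjective x
      rw [← QuotientGroup.mk_pow, hφ.1 x hx, QuotientGroup.mk_one]
    · intro x hx y hy
      obtain ⟨x, rfl⟩ := QuotientGroup.mk_surjective x
      obtain ⟨y, rfl⟩ := QuotientGroup.mk_surjective y
      rw [← QuotientGroup.mk_mul, hφ.2 x hx y hy, QuotientGroup.mk_mul]
  have hcen : ∀ x ∈ φ'.ker, ∀ y, x * y * x⁻¹ * y⁻¹ = 1 := by
    intro x hx y
    obtain ⟨x, rfl⟩ := QuotientGroup.mk_surjective x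
    obtain ⟨y, rfl⟩ := QuotientGroup.mk_surjective y
    exact (QuotientGroup.eq_one_iff (N := L) (x * y * x⁻¹ * y⁻¹)).2
      (Subgroup.commutator_mem_commutator (show x ∈ φ.ker from hx) (Subgroup.mem_top y))
  obtain ⟨f, hf⟩ := exists_hom_of_hasElementaryKernel (maxCover_spec p H) hφ's hφ'
  have hfk : ⁅(maxCover p H).proj.ker, (⊤ : Subgroup (maxCover p H))⁆ ≤ f.ker := by
    refine Subgroup.commutator_le.2 fun m hm e _ => ?_
    rw [MonoidHom.mem_ker, commutatorElement_def, map_mul, map_mul, map_mul, map_inv, map_inv]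
    refine hcen _ ?_ _
    rw [MonoidHom.mem_ker, ← MonoidHom.comp_apply, hf]
    exact hm
  let f' : headCover p H →* E ⧸ L := QuotientGroup.lift _ f hfk
  have hf' : ∀ x, φ' (f' x) = (headCover p H).proj x := fun x => by
    obtain ⟨x, rfl⟩ := QuotientGroup.mk_surjective x
    exact DFunLike.congr_fun hf x
  obtain ⟨x₀, y₀, rfl, rfl, hx₀, hy₀, hxy₀⟩ := h
  have hmk : Function.Surjective (QuotientGroup.mk' L) := QuotientGroup.mk'_surjective L
  obtain ⟨x, hx, hxp⟩ := exists_coprime_lift hmk (not_dvd_orderOf_map f' hx₀)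
  obtain ⟨y, hy, hyp⟩ := exists_coprime_lift hmk (not_dvd_orderOf_map f' hy₀)
  obtain ⟨w, hw, hwp⟩ := exists_coprime_lift hmk (not_dvd_orderOf_map f' hxy₀)
  have hφx : φ x = (headCover p H).proj x₀ := by rw [← hf', ← hx]; rfl
  have hφy : φ y = (headCover p H).proj y₀ := by rw [← hf', ← hy]; rfl
  have hn : w * (x * y)⁻¹ ∈ L := by
    rw [← QuotientGroup.ker_mk' L, MonoidHom.mem_ker, map_mul, map_inv, map_mul, hx, hy, hw,
      map_mul, mul_inv_cancel]
  have hgen : φ.ker ⊔ Subgroup.closure {x, y} = ⊤ := by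
    have : (Subgroup.closure {x, y}).map φ = ⊤ := by
      rw [MonoidHom.map_closure, Set.image_pair, hφx, hφy, hab]
    rw [sup_comm, ← Subgroup.comap_map_eq, this, Subgroup.comap_top]
  obtain ⟨u, hu, v, hv, huv⟩ := exists_conj_mul_conj_eq hφ.2 hgen hn
  refine ⟨u * x * u⁻¹, v * y * v⁻¹, ?_, ?_, ?_, ?_, ?_⟩
  · rw [map_mul, map_mul, map_inv, show φ u = 1 from hu, hφx]; group
  · rw [map_mul, map_mul, map_inv, show φ v = 1 from hv, hφy]; group
  · rwa [orderOf_conj]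
  · rwa [orderOf_conj]
  · rwa [huv, inv_mul_cancel_right]

theorem headCover_proj_surjective [Fact p.Prime] (H : Type u) [Group H] [Finite H] :
    Function.Surjective (headCover p H).proj := fun g => by
  obtain ⟨x, hx⟩ := (maxCover_spec p H).1.1 g
  exact ⟨QuotientGroup.mk x, hx⟩

end Triple

/-! ### Functoriality of braid orbits and cusps -/

section Braid

variable {E F : Type*} [Group E] [Group F] {n : ℕ}

theorem comp_braid (f : E →* F) (i : Fin n) (g : Fin (n + 1) → E) :
    (fun j => f (braid i g j)) = braid i fun j => f (g j) := by
  funext j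
  simp only [braid]
  split_ifs <;> simp

theorem comp_conjTuple {r : ℕ} (f : E →* F) (c : E) (g : Fin r → E) :
    (fun j => f (conjTuple c g j)) = conjTuple (f c) fun j => f (g j) := by
  funext j
  simp [conjTuple]

theorem braid_surjective (i : Fin n) :
    Function.Surjective (braid i : (Fin (n + 1) → E) → Fin (n + 1) → E) := by
  intro g
  refine ⟨fun j => if j = i.castSucc then g i.succ
    else if j = i.succ then (g i.succ)⁻¹ * g i.castSucc * g i.succ else g j, ?_⟩
  have hne : i.succ ≠ i.castSucc := (Fin.castSucc_lt_succ).ne'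
  funext j
  simp only [braid, if_true, if_neg hne]
  split_ifs with h1 h2
  · rw [h1]; group
  · rw [h2]
  · rfl

theorem BraidStep.map (f : E →* F) {g g' : Fin (n + 1) → E} (h : BraidStep g g') :
    BraidStep (fun j => f (g j)) (fun j => f (g' j)) := by
  rcases h with ⟨i, rfl⟩ | ⟨c, rfl⟩
  · exact Or.inl ⟨i, comp_braid f i g⟩
  · exact Or.inr ⟨f c, comp_conjTuple f c g⟩

theorem CuspStep.map (f : E →* F) {g g' : Fin 4 → E} (h : CuspStep g g') :
    CuspStep (fun j => f (g j)) (fun j => f (g' j)) := by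
  rcases h with rfl | rfl | h | ⟨c, rfl⟩
  · exact Or.inl (comp_braid f _ g)
  · exact Or.inr (Or.inl (by simp only [comp_braid]))
  · exact Or.inr (Or.inr (Or.inl (by rw [← comp_braid, ← comp_braid, h])))
  · exact Or.inr (Or.inr (Or.inr ⟨f c, comp_conjTuple f c g⟩))

theorem eqvGen_map {α β : Type*} {r : α → α → Prop} {s : β → β → Prop} (m : α → β)
    (h : ∀ a b, r a b → s (m a) (m b)) {a b : α} (hab : Relation.EqvGen r a b) :
    Relation.EqvGen s (m a) (m b) := by
  induction hab with
  | rel a b hab => exact .rel _ _ (h a b hab)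
  | refl a => exact .refl _
  | symm a b _ ih => exact .symm _ _ ih
  | trans a b c _ _ ih ih' => exact .trans _ _ _ ih ih'

theorem mapsTo_braidOrbit (f : E →* F) (g : Fin (n + 1) → E) :
    Set.MapsTo (fun h j => f (h j)) (braidOrbit g) (braidOrbit fun j => f (g j)) :=
  fun _ h => eqvGen_map (fun (h : Fin (n + 1) → E) j => f (h j)) (fun _ _ => BraidStep.map f) h

theorem mapsTo_cuspSet (f : E →* F) (g : Fin 4 → E) :
    Set.MapsTo (fun h j => f (h j)) (cuspSet g) (cuspSet fun j => f (g j)) :=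
  fun _ h => eqvGen_map (fun (h : Fin 4 → E) j => f (h j)) (fun _ _ => CuspStep.map f) h

theorem BraidStep.exists_lift_right {f : E →* F} (hf : Function.Surjective f)
    {a b : Fin (n + 1) → F} (h : BraidStep a b) (g : Fin (n + 1) → E)
    (hg : (fun j => f (g j)) = a) :
    ∃ g', BraidStep g g' ∧ (fun j => f (g' j)) = b := by
  subst hg
  rcases h with ⟨i, rfl⟩ | ⟨c, rfl⟩
  · exact ⟨_, Or.inl ⟨i, rfl⟩, comp_braid f i g⟩
  · obtain ⟨c, rfl⟩ := hf c
    exact ⟨_, Or.inr ⟨c, rfl⟩, comp_conjTuple f c g⟩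

theorem BraidStep.exists_lift_left {f : E →* F} (hf : Function.Surjective f)
    {a b : Fin (n + 1) → F} (h : BraidStep a b) (g : Fin (n + 1) → E)
    (hg : (fun j => f (g j)) = b) :
    ∃ g', BraidStep g' g ∧ (fun j => f (g' j)) = a := by
  rcases h with ⟨i, rfl⟩ | ⟨c, rfl⟩
  · obtain ⟨g', rfl⟩ := braid_surjective i g
    refine ⟨g', Or.inl ⟨i, rfl⟩, ?_⟩
    rw [comp_braid] at hg
    have hne : i.succ ≠ i.castSucc := (Fin.castSucc_lt_succ).ne'
    have h1 : f (g' i.castSucc) = a i.castSucc := by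
      have := congrFun hg i.succ
      simpa only [braid, if_neg hne, if_true] using this
    funext j
    have h2 := congrFun hg j
    simp only [braid] at h2
    split_ifs at h2 with h3 h4
    · rw [h3, h1]
    · have h5 := congrFun hg i.castSucc
      simp only [braid, if_true, h1] at h5
      rw [h4]
      exact mul_left_cancel (mul_right_cancel h5)
    · exact h2
  · obtain ⟨c, rfl⟩ := hf c
    refine ⟨conjTuple c⁻¹ g, Or.inr ⟨c, ?_⟩, ?_⟩
    · funext j; simp [conjTuple, mul_assoc]
    · rw [comp_conjTuple, hg]; funext j; simp [conjTuple, mul_assoc]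

/-- Braid equivalences can be lifted along an epimorphism, starting from any lift of either end. -/
theorem exists_mem_braidOrbit_lift {f : E →* F} (hf : Function.Surjective f)
    {g : Fin (n + 1) → E} {b : Fin (n + 1) → F} (hb : b ∈ braidOrbit fun j => f (g j)) :
    ∃ g' ∈ braidOrbit g, (fun j => f (g' j)) = b := by
  have key : ∀ a b : Fin (n + 1) → F, Relation.EqvGen BraidStep a b →
      (∀ g : Fin (n + 1) → E, (fun j => f (g j)) = a →
        ∃ g', Relation.EqvGen BraidStep g g' ∧ (fun j => f (g' j)) = b) ∧
      (∀ g : Fin (n + 1) → E, (fun j => f (g j)) = b →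
        ∃ g', Relation.EqvGen BraidStep g g' ∧ (fun j => f (g' j)) = a) := by
    intro a b hab
    induction hab with
    | rel a b hab =>
      refine ⟨fun g hg => ?_, fun g hg => ?_⟩
      · obtain ⟨g', h1, h2⟩ := hab.exists_lift_right hf g hg
        exact ⟨g', .rel _ _ h1, h2⟩
      · obtain ⟨g', h1, h2⟩ := hab.exists_lift_left hf g hg
        exact ⟨g', .symm _ _ (.rel _ _ h1), h2⟩
    | refl a => exact ⟨fun g hg => ⟨g, .refl _, hg⟩, fun g hg => ⟨g, .refl _, hg⟩⟩
    | symm a b _ ih => exact ih.symm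
    | trans a b c _ _ ih ih' =>
      refine ⟨fun g hg => ?_, fun g hg => ?_⟩
      · obtain ⟨g', h1, h2⟩ := ih.1 g hg
        obtain ⟨g'', h3, h4⟩ := ih'.1 g' h2
        exact ⟨g'', .trans _ _ _ h1 h3, h4⟩
      · obtain ⟨g', h1, h2⟩ := ih'.2 g hg
        obtain ⟨g'', h3, h4⟩ := ih.2 g' h2
        exact ⟨g'', .trans _ _ _ h1 h3, h4⟩
  exact (key _ _ hb).1 g rfl

/-- Braiding preserves product-one triples of elements of order prime to `p`. -/
theorem coprime_and_prod_eq_one_of_mem_braidOrbit {p : ℕ} {g g' : Fin 3 → E}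
    (h : g' ∈ braidOrbit g) (hg : (∀ i, ¬ p ∣ orderOf (g i)) ∧ g 0 * g 1 * g 2 = 1) :
    (∀ i, ¬ p ∣ orderOf (g' i)) ∧ g' 0 * g' 1 * g' 2 = 1 := by
  have hconj : ∀ c a : E, c * a * c⁻¹ = 1 ↔ a = 1 := fun c a => conj_eq_one_iff
  have key : ∀ a b : Fin 3 → E, BraidStep a b →
      (((∀ i, ¬ p ∣ orderOf (a i)) ∧ a 0 * a 1 * a 2 = 1) ↔
        ((∀ i, ¬ p ∣ orderOf (b i)) ∧ b 0 * b 1 * b 2 = 1)) := by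
    rintro a b (⟨i, rfl⟩ | ⟨c, rfl⟩)
    · simp only [Fin.forall_fin_succ, Fin.forall_fin_zero]
      fin_cases i
      · simp [braid, orderOf_conj, and_left_comm]
      · have : a 0 * (a 1 * a 2 * (a 1)⁻¹) * a 1 = a 0 * a 1 * a 2 := by group
        simp [braid, orderOf_conj, this, and_comm]
    · have : conjTuple c a 0 * conjTuple c a 1 * conjTuple c a 2
          = c * (a 0 * a 1 * a 2) * c⁻¹ := by simp only [conjTuple]; group
      rw [this, hconj]
      simp only [conjTuple, orderOf_conj]
  have key' : ∀ a b : Fin 3 → E, Relation.EqvGen BraidStep a b →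
      (((∀ i, ¬ p ∣ orderOf (a i)) ∧ a 0 * a 1 * a 2 = 1) ↔
        ((∀ i, ¬ p ∣ orderOf (b i)) ∧ b 0 * b 1 * b 2 = 1)) := by
    intro a b hab
    induction hab with
    | rel a b hab => exact key a b hab
    | refl a => exact Iff.rfl
    | symm a b _ ih => exact ih.symm
    | trans a b c _ _ ih ih' => exact ih.trans ih'
  exact (key' _ _ h).1 hg

end Braid

/-! ### Compatible lifts to the tower -/

section Tower

variable {p : ℕ} [Fact p.Prime]

theorem step_isMaxElementaryFrattini (G : Type u) [Group G] [Finite G] (k : ℕ) :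
    IsMaxElementaryFrattini p (step p G k) :=
  maxCover_spec p (tower p G k)

/-- A component branch over the braid orbit of `g` contains a compatible sequence of tuples that
starts at `g` itself, as the maps between the orbits are surjective. -/
theorem exists_sequence_of_isComponentBranch {H : Type u} [Group H] [Finite H] {n : ℕ}
    {C : Fin (n + 1) → ConjClasses H} {O : ∀ k, Set (Fin (n + 1) → tower p H k)}
    (hO : IsComponentBranch p C O) {g : Fin (n + 1) → H} (hg : StartsAt p O g) :
    ∃ h : ∀ k, Fin (n + 1) → tower p H k, (∀ i, (tower p H 0).proj (h 0 i) = g i) ∧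
      (∀ k i, step p H k (h (k + 1) i) = h k i) ∧ ∀ k, h k ∈ O k := by
  -- Every element of `O k` is braid equivalent to the image of a representative of `O (k + 1)`.
  have hsurj : ∀ k, ∀ a ∈ O k, ∃ b ∈ O (k + 1), (fun i => step p H k (b i)) = a := by
    intro k a ha
    obtain ⟨c, -, hc⟩ := hO.1 (k + 1)
    obtain ⟨d, -, hd⟩ := hO.1 k
    have h1 : (fun i => step p H k (c i)) ∈ O k :=
      hO.2 k (by rw [hc]; exact Relation.EqvGen.refl c)
    rw [hd] at h1 ha
    rw [hc]
    exact exists_mem_braidOrbit_lift (step_isMaxElementaryFrattini H k).1.1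
      (Relation.EqvGen.trans _ _ _ (Relation.EqvGen.symm _ _ h1) ha)
  have h0 : g ∈ (fun (h : Fin (n + 1) → tower p H 0) i => (tower p H 0).proj (h i)) '' O 0 := by
    rw [show _ '' O 0 = braidOrbit g from hg]
    exact Relation.EqvGen.refl g
  obtain ⟨a, ha, hag⟩ := h0
  choose s hs hs' using hsurj
  let q : ∀ k, {a // a ∈ O k} := fun k =>
    Nat.rec (motive := fun k => {a // a ∈ O k}) ⟨a, ha⟩ (fun k b => ⟨s k b.1 b.2, hs k b.1 b.2⟩) k
  exact ⟨fun k => (q k).1, fun i => congrFun hag i,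
    fun k i => congrFun (hs' k (q k).1 (q k).2) i, fun k => (q k).2⟩

/-- A homomorphism of finite groups extends to a homomorphism of their `p`-Frattini towers. -/
theorem exists_tower_hom {H G : Type u} [Group H] [Finite H] [Group G] [Finite G] (μ : H →* G) :
    ∃ m : ∀ k, tower p H k →* tower p G k,
      (∀ x, (tower p G 0).proj (m 0 x) = μ ((tower p H 0).proj x)) ∧
      ∀ k x, step p G k (m (k + 1) x) = m k (step p H k x) := by
  have hex : ∀ k (f : tower p H k →* tower p G k), ∃ f' : tower p H (k + 1) →* tower p G (k + 1),
      (step p G k).comp f' = f.comp (step p H k) := fun k f =>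
    exists_hom_lift (step_isMaxElementaryFrattini H k)
      (step_isMaxElementaryFrattini G k).1.1 (step_isMaxElementaryFrattini G k).2.1 f
  choose F hF using hex
  let m : ∀ k, tower p H k →* tower p G k := fun k =>
    Nat.rec (motive := fun k => tower p H k →* tower p G k) μ F k
  exact ⟨m, fun x => rfl, fun k x => DFunLike.congr_fun (hF k (m k)) x⟩

/-- A pair `a`, `b` of elements of `G` lifts compatibly along the whole tower to pairs of elements
of order prime to `p` whose products have order prime to `p`. -/
def HasTowerLift (p : ℕ) [Fact p.Prime] {G : Type u} [Group G] [Finite G] (a b : G) : Prop :=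
  ∃ x y : ∀ k, tower p G k,
    ((tower p G 0).proj (x 0) = a ∧ (tower p G 0).proj (y 0) = b) ∧
    (∀ k, step p G k (x (k + 1)) = x k ∧ step p G k (y (k + 1)) = y k) ∧
    ∀ k, ¬ p ∣ orderOf (x k) ∧ ¬ p ∣ orderOf (y k) ∧ ¬ p ∣ orderOf (x k * y k)

theorem HasTowerLift.map {H G : Type u} [Group H] [Finite H] [Group G] [Finite G] (μ : H →* G)
    {a b : H} (h : HasTowerLift p a b) : HasTowerLift p (μ a) (μ b) := by
  obtain ⟨m, hm0, hm⟩ := exists_tower_hom (p := p) μ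
  obtain ⟨x, y, ⟨rfl, rfl⟩, h1, h2⟩ := h
  refine ⟨fun k => m k (x k), fun k => m k (y k), ⟨hm0 _, hm0 _⟩, fun k => ⟨?_, ?_⟩,
    fun k => ⟨not_dvd_orderOf_map _ (h2 k).1, not_dvd_orderOf_map _ (h2 k).2.1, ?_⟩⟩
  · rw [hm, (h1 k).1]
  · rw [hm, (h1 k).2]
  · rw [← map_mul]
    exact not_dvd_orderOf_map _ (h2 k).2.2

/-- A component branch over the orbit of a triple provides tower lifts of the first two and of
the last two entries; the remaining entry is the inverse of their product. -/
theorem hasTowerLift_of_isComponentBranch {H : Type u} [Group H] [Finite H]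
    {C : Fin 3 → ConjClasses H} {O : ∀ k, Set (Fin 3 → tower p H k)}
    (hO : IsComponentBranch p C O) {g : Fin 3 → H} (hg : StartsAt p O g) :
    HasTowerLift p (g 0) (g 1) ∧ HasTowerLift p (g 1) (g 2) := by
  obtain ⟨h, h0, h1, h2⟩ := exists_sequence_of_isComponentBranch hO hg
  have h3 : ∀ k, (∀ i, ¬ p ∣ orderOf (h k i)) ∧ h k 0 * h k 1 * h k 2 = 1 := fun k => by
    obtain ⟨c, ⟨-, hc1, -, hc2⟩, hc⟩ := hO.1 k
    have hk := h2 k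
    rw [hc] at hk
    refine coprime_and_prod_eq_one_of_mem_braidOrbit hk ⟨hc1, ?_⟩
    simpa [List.ofFn_succ, mul_assoc] using hc2
  refine ⟨⟨fun k => h k 0, fun k => h k 1, ⟨h0 0, h0 1⟩, fun k => ⟨h1 k 0, h1 k 1⟩,
    fun k => ⟨(h3 k).1 0, (h3 k).1 1, ?_⟩⟩, ⟨fun k => h k 1, fun k => h k 2, ⟨h0 1, h0 2⟩,
    fun k => ⟨h1 k 1, h1 k 2⟩, fun k => ⟨(h3 k).1 1, (h3 k).1 2, ?_⟩⟩⟩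
  · rw [eq_inv_of_mul_eq_one_left (h3 k).2]
    exact not_dvd_orderOf_inv ((h3 k).1 2)
  · have h4 : h k 0 * (h k 1 * h k 2) = 1 := by rw [← mul_assoc]; exact (h3 k).2
    rw [eq_inv_of_mul_eq_one_right h4]
    exact not_dvd_orderOf_inv ((h3 k).1 0)

end Tower

/-! ### Gluing along the middle product -/

section Glue

variable {p : ℕ} {E F : Type*} [Group E] [Group F]

/-- A conjugation between the images of two elements of order prime to `p` lifts to a conjugation
between the elements. -/
theorem exists_conj_lift [Fact p.Prime] {φ : E →* F} (hs : Function.Surjective φ)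
    (hφ : HasElementaryKernel p φ) {s t : E} (hsp : ¬ p ∣ orderOf s) (htp : ¬ p ∣ orderOf t) {c : F}
    (hc : c * φ s * c⁻¹ = φ t) : ∃ u, φ u = c ∧ u * s * u⁻¹ = t := by
  obtain ⟨d, rfl⟩ := hs c
  obtain ⟨v, hv, hvt⟩ := exists_conj_eq hφ (x := d * s * d⁻¹) (y := t) (by rwa [orderOf_conj]) htp
    (by rw [map_mul, map_mul, map_inv, hc])
  refine ⟨v * d, by rw [map_mul, show φ v = 1 from hv, one_mul], ?_⟩
  rw [← hvt]
  group

theorem IsOnlyCusp.of_map (f : E →* F) {g : Fin 4 → E} (hg : ¬ p ∣ orderOf (g 1 * g 2))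
    (h : IsOnlyCusp p fun i => f (g i)) : IsOnlyCusp p g := by
  have hmap : ∀ a b : E, IsPrimeToP p (Subgroup.closure {a, b}) →
      IsPrimeToP p (Subgroup.closure {f a, f b}) := by
    intro a b hab y hy
    rw [← Set.image_pair, ← MonoidHom.map_closure] at hy
    obtain ⟨x, hx, rfl⟩ := hy
    exact not_dvd_orderOf_map f (hab x hx)
  exact ⟨hg, fun hgr => h.2 ⟨hmap _ _ hgr.1, hmap _ _ hgr.2⟩⟩

theorem mem_nielsenClass_of_map {G : Type*} [Group G] {r : ℕ} {π : F →* G} {f : E →* F}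
    (hf : IsFrattini f) {C : Fin r → ConjClasses G} {g : Fin r → E}
    (h : (fun i => f (g i)) ∈ nielsenClass p π C) (hg : ∀ i, ¬ p ∣ orderOf (g i))
    (hprod : (List.ofFn g).prod = 1) : g ∈ nielsenClass p (π.comp f) C := by
  refine ⟨h.1, hg, hf.2 _ ?_, hprod⟩
  rw [MonoidHom.map_closure, ← Set.range_comp]
  exact h.2.2.1

/-- The tuple `(u a u⁻¹, x, y, u d u⁻¹)` obtained by conjugating the pair `(d, a)` so that
`u d a u⁻¹` becomes the inverse of `x y`. -/
def glue (x y d a u : E) : Fin 4 → E := ![u * a * u⁻¹, x, y, u * d * u⁻¹]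

theorem prod_glue {x y d a u : E} (h : u * (d * a) * u⁻¹ = (x * y)⁻¹) :
    (List.ofFn (glue x y d a u)).prod = 1 := by
  have h1 : x * y = u * (d * a)⁻¹ * u⁻¹ := by
    rw [← inv_inv (x * y), ← h]; group
  have h2 : (List.ofFn (glue x y d a u)).prod = u * a * u⁻¹ * (x * y) * (u * d * u⁻¹) := by
    simp [glue, List.ofFn_succ, mul_assoc]
  rw [h2, h1]
  group

theorem map_glue (f : E →* F) (x y d a u : E) :
    (fun i => f (glue x y d a u i)) = glue (f x) (f y) (f d) (f a) (f u) := by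
  funext i
  fin_cases i <;> simp [glue]

theorem not_dvd_orderOf_glue {x y d a : E} (u : E) (hx : ¬ p ∣ orderOf x) (hy : ¬ p ∣ orderOf y)
    (hd : ¬ p ∣ orderOf d) (ha : ¬ p ∣ orderOf a) (i : Fin 4) :
    ¬ p ∣ orderOf (glue x y d a u i) := by
  fin_cases i
  · simpa [glue, orderOf_conj] using ha
  · exact hx
  · exact hy
  · simpa [glue, orderOf_conj] using hd

theorem glue_one (g : Fin 4 → E) : glue (g 1) (g 2) (g 3) (g 0) 1 = g := by
  funext i
  fin_cases i <;> simp [glue]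

theorem mul_eq_inv_of_prod {g : Fin 4 → E} (h : (List.ofFn g).prod = 1) :
    g 3 * g 0 = (g 1 * g 2)⁻¹ := by
  have h1 : g 0 * (g 1 * g 2 * g 3) = 1 := by simpa [List.ofFn_succ, mul_assoc] using h
  have h2 : g 1 * g 2 * (g 3 * g 0) = 1 := by
    rw [← mul_assoc]; exact mul_eq_one_comm.1 h1
  exact eq_inv_of_mul_eq_one_right h2

end Glue

/-! ### Lifting invariants -/

section Invariant

variable {p : ℕ} [Fact p.Prime]

theorem liftingInvariant_fin_three (p : ℕ) {R H : Type*} [Group R] [Group H] (ψ : R →* H)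
    (g : Fin 3 → H) : liftingInvariant p ψ g =
      coprimeLift p ψ (g 0) * coprimeLift p ψ (g 1) * coprimeLift p ψ (g 2) := by
  simp [liftingInvariant, List.ofFn_succ, mul_assoc]

/-- The lifting criterion for a subgroup `H` of the base, applied to the preimage of `H`. -/
theorem HasCoprimeLift.of_headCover_subgroup {E G : Type u} [Group E] [Finite E] [Group G]
    [Finite G] {φ : E →* G} (hs : Function.Surjective φ) (hφ : HasElementaryKernel p φ)
    {H : Subgroup G} {a b : H} (hab : Subgroup.closure {(a : G), (b : G)} = H)
    (h : HasCoprimeLift p (headCover p H).proj a b) : HasCoprimeLift p φ (a : G) (b : G) := by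
  have hgen : Subgroup.closure {a, b} = ⊤ := by
    apply Subgroup.map_injective H.subtype_injective
    rw [MonoidHom.map_closure, Set.image_pair, ← MonoidHom.range_eq_map, H.range_subtype]
    exact hab
  have hker : ∀ z ∈ (φ.subgroupComap H).ker, z.1 ∈ φ.ker := fun z hz => congrArg Subtype.val hz
  obtain ⟨x, y, hx, hy, hxp, hyp, hxyp⟩ := h.of_headCover (φ := φ.subgroupComap H)
    (fun z => by
      obtain ⟨e, he⟩ := hs z
      exact ⟨⟨e, by rw [Subgroup.mem_comap, he]; exact z.2⟩, Subtype.ext he⟩)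
    ⟨fun z hz => Subtype.ext (hφ.1 _ (hker z hz)),
      fun z hz w hw => Subtype.ext (hφ.2 _ (hker z hz) _ (hker w hw))⟩ hgen
  refine ⟨x, y, congrArg Subtype.val hx, congrArg Subtype.val hy, ?_, ?_, ?_⟩
  · rwa [Subgroup.orderOf_coe]
  · rwa [Subgroup.orderOf_coe]
  · rwa [← Subgroup.coe_mul, Subgroup.orderOf_coe]

theorem hasCoprimeLift_of_liftingInvariant_triple23 {E F : Type u} [Group E] [Finite E]
    [Group F] [Finite F] {φ : E →* F} (hs : Function.Surjective φ) (hφ : HasElementaryKernel p φ)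
    {g : Fin 4 → F} (hg : ∀ i, ¬ p ∣ orderOf (g i)) (hm : ¬ p ∣ orderOf (g 1 * g 2))
    (h : liftingInvariant p (headCover p (H23 g)).proj (triple23 g) = 1) :
    HasCoprimeLift p φ (g 1) (g 2) := by
  have key : ∀ a : H23 g, ¬ p ∣ orderOf (a : F) →
      (headCover p (H23 g)).proj (coprimeLift p (headCover p (H23 g)).proj a) = a ∧
      ¬ p ∣ orderOf (coprimeLift p (headCover p (H23 g)).proj a) := fun a ha =>
    coprimeLift_spec (exists_coprime_lift (headCover_proj_surjective _)
      (by rwa [← Subgroup.orderOf_coe]))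
  obtain ⟨h0, h0'⟩ := key (triple23 g 0) (hg 1)
  obtain ⟨h1, h1'⟩ := key (triple23 g 1) (hg 2)
  obtain ⟨-, h2'⟩ := key (triple23 g 2) (not_dvd_orderOf_inv hm)
  refine HasCoprimeLift.of_headCover_subgroup hs hφ (a := triple23 g 0) (b := triple23 g 1)
    rfl ⟨_, _, h0, h1, h0', h1', ?_⟩
  have h3 : coprimeLift p (headCover p (H23 g)).proj (triple23 g 0) *
      coprimeLift p (headCover p (H23 g)).proj (triple23 g 1) *
      coprimeLift p (headCover p (H23 g)).proj (triple23 g 2) = 1 := by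
    rwa [← liftingInvariant_fin_three]
  rw [eq_inv_of_mul_eq_one_left h3]
  exact not_dvd_orderOf_inv h2'

/-- In this triple the entry to be inverted comes first, so it is the product of the lifts of the
last two entries that has order prime to `p`. -/
theorem hasCoprimeLift_of_liftingInvariant_triple14 {E F : Type u} [Group E] [Finite E]
    [Group F] [Finite F] {φ : E →* F} (hs : Function.Surjective φ) (hφ : HasElementaryKernel p φ)
    {g : Fin 4 → F} (hg : ∀ i, ¬ p ∣ orderOf (g i)) (hm : ¬ p ∣ orderOf (g 3 * g 0))
    (h : liftingInvariant p (headCover p (H14 g)).proj (triple14 g) = 1) :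
    HasCoprimeLift p φ (g 3) (g 0) := by
  have key : ∀ a : H14 g, ¬ p ∣ orderOf (a : F) →
      (headCover p (H14 g)).proj (coprimeLift p (headCover p (H14 g)).proj a) = a ∧
      ¬ p ∣ orderOf (coprimeLift p (headCover p (H14 g)).proj a) := fun a ha =>
    coprimeLift_spec (exists_coprime_lift (headCover_proj_surjective _)
      (by rwa [← Subgroup.orderOf_coe]))
  obtain ⟨-, h0'⟩ := key (triple14 g 0) (not_dvd_orderOf_inv hm)
  obtain ⟨h1, h1'⟩ := key (triple14 g 1) (hg 3)
  obtain ⟨h2, h2'⟩ := key (triple14 g 2) (hg 0)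
  refine HasCoprimeLift.of_headCover_subgroup hs hφ (a := triple14 g 1) (b := triple14 g 2)
    (congrArg Subgroup.closure (Set.pair_comm (g 3) (g 0))) ⟨_, _, h1, h2, h1', h2', ?_⟩
  have h3 : coprimeLift p (headCover p (H14 g)).proj (triple14 g 0) *
      (coprimeLift p (headCover p (H14 g)).proj (triple14 g 1) *
      coprimeLift p (headCover p (H14 g)).proj (triple14 g 2)) = 1 := by
    rwa [← mul_assoc, ← liftingInvariant_fin_three]
  rw [eq_inv_of_mul_eq_one_right h3]
  exact not_dvd_orderOf_inv h0'

theorem repCoverMap_spec {G : Type u} [Group G] [Finite G] (H : Subgroup G) (hH : IsPPerfect p H)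
    (hG : IsPPerfect p G) (x : repCover p H hH) :
    (repCover p G hG).proj (repCoverMap p H hH hG x) = (repCover p H hH).proj x :=
  DFunLike.congr_fun (existsUnique_repCoverMap p H hH hG).choose_spec.1 x

/-- The maps between representation covers respect lifts of order prime to `p`. -/
theorem repCoverMap_coprimeLift {G : Type u} [Group G] [Finite G] (H : Subgroup G)
    (hH : IsPPerfect p H) (hG : IsPPerfect p G) (a : H) (ha : ¬ p ∣ orderOf (a : G)) :
    repCoverMap p H hH hG (coprimeLift p (repCover p H hH).proj a) =
      coprimeLift p (repCover p G hG).proj (a : G) := by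
  obtain ⟨h1, h2⟩ := coprimeLift_spec (exists_coprime_lift (p := p) (repCover_spec p H hH).1.1
    (g := a) (by rwa [← Subgroup.orderOf_coe]))
  have h3 := coprimeLift_eq (repCover_spec p G hG).2.1
    (not_dvd_orderOf_map (repCoverMap p H hH hG) h2)
  rw [repCoverMap_spec, h1] at h3
  exact h3.symm

theorem coprimeLift_inv {R G : Type*} [Group R] [Finite R] [Group G] {ψ : R →* G}
    (hψ : IsCentralPExtension p ψ) {a : G} (ha : ¬ p ∣ orderOf a) :
    coprimeLift p ψ a⁻¹ = (coprimeLift p ψ a)⁻¹ := by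
  obtain ⟨h1, h2⟩ := coprimeLift_spec (exists_coprime_lift hψ.1 ha)
  have h3 := coprimeLift_eq hψ (not_dvd_orderOf_inv h2)
  rwa [map_inv, h1] at h3

end Invariant

/-! ### The three properties of o-`p'` cusps -/

section OnlyCusp

variable {p : ℕ} [Fact p.Prime] {G : Type u} [Group G] [Finite G] {C : Fin 4 → ConjClasses G}

/-- The product formula: the lifting invariant of `g` is the product of those of its two triples. -/
theorem liftingInvariant_eq_mul {g : Fin 4 → G} (hg : g ∈ nielsenClass p (MonoidHom.id G) C)
    (ho : IsOnlyCusp p g) :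
    ∃ (hG : IsPPerfect p G) (h14 : IsPPerfect p (H14 g)) (h23 : IsPPerfect p (H23 g)),
      liftingInvariant p (repCover p G hG).proj g =
        repCoverMap p (H14 g) h14 hG
          (liftingInvariant p (repCover p (H14 g) h14).proj (triple14 g)) *
        repCoverMap p (H23 g) h23 hG
          (liftingInvariant p (repCover p (H23 g) h23).proj (triple23 g)) := by
  obtain ⟨-, hp, hgen, hprod⟩ := hg
  have hperf : ∀ a b : G, ¬ p ∣ orderOf a → ¬ p ∣ orderOf b →
      IsPPerfect p (Subgroup.closure {a, b}) := fun a b ha hb => by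
    refine isPPerfect_of_closure (Subgroup.closure_closure_coe_preimage (k := {a, b})) ?_
    rintro ⟨s, hs'⟩ hs
    rw [← Subgroup.orderOf_coe]
    rcases hs with hs | hs <;> · change s = _ at hs; subst hs; assumption
  have hG : IsPPerfect p G :=
    isPPerfect_of_closure hgen (by rintro _ ⟨i, rfl⟩; exact hp i)
  have h14 : IsPPerfect p (H14 g) := hperf _ _ (hp 0) (hp 3)
  have h23 : IsPPerfect p (H23 g) := hperf _ _ (hp 1) (hp 2)
  refine ⟨hG, h14, h23, ?_⟩
  have hc := (repCover_spec p G hG).2.1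
  have hinv := mul_eq_inv_of_prod hprod
  have hda : ¬ p ∣ orderOf (g 3 * g 0) := by rw [hinv]; exact not_dvd_orderOf_inv ho.1
  let l : G → repCover p G hG := coprimeLift p (repCover p G hG).proj
  have hl : ∀ a, ¬ p ∣ orderOf a → (repCover p G hG).proj (l a) = a := fun a ha =>
    (coprimeLift_spec (exists_coprime_lift hc.1 ha)).1
  have e14 : repCoverMap p (H14 g) h14 hG
      (liftingInvariant p (repCover p (H14 g) h14).proj (triple14 g)) =
      l (g 1 * g 2) * (l (g 3) * l (g 0)) := by
    rw [liftingInvariant_fin_three, map_mul, map_mul, mul_assoc,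
      repCoverMap_coprimeLift _ _ _ (triple14 g 0) (not_dvd_orderOf_inv hda),
      repCoverMap_coprimeLift _ _ _ (triple14 g 1) (hp 3),
      repCoverMap_coprimeLift _ _ _ (triple14 g 2) (hp 0)]
    change l (g 3 * g 0)⁻¹ * (l (g 3) * l (g 0)) = _
    rw [hinv, inv_inv]
  have e23 : repCoverMap p (H23 g) h23 hG
      (liftingInvariant p (repCover p (H23 g) h23).proj (triple23 g)) =
      l (g 1) * (l (g 2) * (l (g 1 * g 2))⁻¹) := by
    rw [liftingInvariant_fin_three, map_mul, map_mul, mul_assoc,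
      repCoverMap_coprimeLift _ _ _ (triple23 g 0) (hp 1),
      repCoverMap_coprimeLift _ _ _ (triple23 g 1) (hp 2),
      repCoverMap_coprimeLift _ _ _ (triple23 g 2) (not_dvd_orderOf_inv ho.1)]
    change l (g 1) * (l (g 2) * l (g 1 * g 2)⁻¹) = _
    rw [show l (g 1 * g 2)⁻¹ = (l (g 1 * g 2))⁻¹ from coprimeLift_inv hc ho.1]
  have e : liftingInvariant p (repCover p G hG).proj g =
      l (g 0) * (l (g 1) * (l (g 2) * l (g 3))) := by
    simp only [liftingInvariant, List.ofFn_succ, List.ofFn_zero, List.prod_cons, List.prod_nil,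
      mul_one]
    rfl
  -- The lifting invariants of `g` and of the triple `(g₂, g₃, (g₂ g₃)⁻¹)` lie in the kernel,
  -- hence are central.
  have hcen : ∀ z, (repCover p G hG).proj z = 1 → ∀ x, x * z = z * x := fun z hz =>
    Subgroup.mem_center_iff.1 (hc.2.1 hz)
  have c1 := hcen (l (g 0) * (l (g 1) * (l (g 2) * l (g 3)))) (by
    simp only [map_mul, hl _ (hp _)]
    simpa [List.ofFn_succ, mul_assoc] using hprod) (l (g 0))⁻¹
  have c2 := hcen (l (g 1) * (l (g 2) * (l (g 1 * g 2))⁻¹)) (by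
    simp only [map_mul, map_inv, hl _ (hp _), hl _ ho.1]
    group) (l (g 1 * g 2) * (l (g 3) * l (g 0)))
  rw [e, e14, e23, c2]
  generalize l (g 1 * g 2) = w at *
  calc _ = (l (g 0))⁻¹ * (l (g 0) * (l (g 1) * (l (g 2) * l (g 3)))) * l (g 0) := by
        rw [c1]; group
    _ = _ := by group

/-- If both triples have trivial lifting invariant, lifts of them are glued along the middle product
by conjugating one of them by an element of the kernel. -/
theorem exists_lift_of_liftingInvariant {k : ℕ} {g : Fin 4 → tower p G k}
    (hg : g ∈ nielsenClass p (tower p G k).proj C) (ho : IsOnlyCusp p g)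
    (h23 : liftingInvariant p (headCover p (H23 g)).proj (triple23 g) = 1)
    (h14 : liftingInvariant p (headCover p (H14 g)).proj (triple14 g) = 1) :
    ∃ g' ∈ nielsenClass p (tower p G (k + 1)).proj C,
      IsOnlyCusp p g' ∧ ∀ i, step p G k (g' i) = g i := by
  have hinv := mul_eq_inv_of_prod hg.2.2.2
  have hda : ¬ p ∣ orderOf (g 3 * g 0) := by rw [hinv]; exact not_dvd_orderOf_inv ho.1
  obtain ⟨hF, hK, -⟩ := step_isMaxElementaryFrattini (p := p) G k
  obtain ⟨x, y, hx, hy, hxp, hyp, hxyp⟩ :=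
    hasCoprimeLift_of_liftingInvariant_triple23 hF.1 hK hg.2.1 ho.1 h23
  obtain ⟨d, a, hd, ha, hdp, hap, hdap⟩ :=
    hasCoprimeLift_of_liftingInvariant_triple14 hF.1 hK hg.2.1 hda h14
  obtain ⟨u, hu, hut⟩ := exists_conj_lift hF.1 hK hdap (not_dvd_orderOf_inv hxyp) (c := 1) (by
    rw [map_inv, map_mul, map_mul, hx, hy, hd, ha, hinv]; group)
  have hmap : (fun i => step p G k (glue x y d a u i)) = g := by
    rw [map_glue, hx, hy, hd, ha, hu, glue_one]
  refine ⟨glue x y d a u, mem_nielsenClass_of_map hF (by rwa [hmap])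
    (not_dvd_orderOf_glue u hxp hyp hdp hap) (prod_glue hut),
    IsOnlyCusp.of_map (step p G k) hxyp (by rwa [hmap]), congrFun hmap⟩

/-- Compatible lifts of `(g₂, g₃)` and `(g₄, g₁)` along the tower are glued by a compatible sequence
of conjugations, constructed level by level. -/
theorem exists_tower_of_hasTowerLift {g : Fin 4 → G}
    (hg : g ∈ nielsenClass p (MonoidHom.id G) C) (ho : IsOnlyCusp p g)
    (h23 : HasTowerLift p (g 1) (g 2)) (h14 : HasTowerLift p (g 3) (g 0)) :
    ∃ b : ∀ k, Fin 4 → tower p G k, (∀ i, (tower p G 0).proj (b 0 i) = g i) ∧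
      (∀ k i, step p G k (b (k + 1) i) = b k i) ∧
      ∀ k, b k ∈ nielsenClass p (tower p G k).proj C ∧ IsOnlyCusp p (b k) := by
  obtain ⟨x, y, ⟨hx0, hy0⟩, hxy, hxyp⟩ := h23
  obtain ⟨d, a, ⟨hd0, ha0⟩, hda, hdap⟩ := h14
  -- `U k` consists of the elements of `G_k` that match the two halves at level `k`.
  let U : ℕ → Type u := fun k =>
    {u : tower p G k // u * (d k * a k) * u⁻¹ = (x k * y k)⁻¹}
  have hstep : ∀ k (u : U k), ∃ v : U (k + 1), step p G k v.1 = u.1 := fun k u => by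
    obtain ⟨hF, hK, -⟩ := step_isMaxElementaryFrattini (p := p) G k
    obtain ⟨v, hv, hvt⟩ := exists_conj_lift hF.1 hK (hdap (k + 1)).2.2
      (not_dvd_orderOf_inv (hxyp (k + 1)).2.2) (c := u.1) (by
        rw [map_inv, map_mul, map_mul, (hxy k).1, (hxy k).2, (hda k).1, (hda k).2]
        exact u.2)
    exact ⟨⟨v, hvt⟩, hv⟩
  choose s hs using hstep
  change x 0 = g 1 at hx0
  change y 0 = g 2 at hy0
  change d 0 = g 3 at hd0
  change a 0 = g 0 at ha0
  have hu0 : (1 : tower p G 0) * (d 0 * a 0) * 1⁻¹ = (x 0 * y 0)⁻¹ := by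
    rw [hx0, hy0, hd0, ha0, inv_one, one_mul, mul_one]
    exact mul_eq_inv_of_prod hg.2.2.2
  let u : ∀ k, U k := fun k => Nat.rec (motive := U) ⟨1, hu0⟩ s k
  let b : ∀ k, Fin 4 → tower p G k := fun k => glue (x k) (y k) (d k) (a k) (u k).1
  have hb0 : b 0 = g := by
    change glue (x 0) (y 0) (d 0) (a 0) (1 : tower p G 0) = g
    rw [hx0, hy0, hd0, ha0]
    exact glue_one g
  have hb : ∀ k, (fun i => step p G k (b (k + 1) i)) = b k := fun k => by
    rw [map_glue, (hxy k).1, (hxy k).2, (hda k).1, (hda k).2, hs k (u k)]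
  refine ⟨b, congrFun hb0, fun k => congrFun (hb k), fun k => ?_⟩
  induction k with
  | zero => rw [hb0]; exact ⟨hg, ho⟩
  | succ k ih =>
    refine ⟨mem_nielsenClass_of_map (step_isMaxElementaryFrattini G k).1 (by rw [hb k]; exact ih.1)
      (not_dvd_orderOf_glue _ (hxyp _).1 (hxyp _).2.1 (hdap _).1 (hdap _).2.1) (prod_glue (u _).2),
      IsOnlyCusp.of_map (step p G k) (hxyp _).2.2 (by rw [hb k]; exact ih.2)⟩

end OnlyCusp

end ModularTower

theorem mainTheorem8 (p : ℕ) [Fact p.Prime] (G : Type u) [Group G] [Finite G]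
    (C : Fin 4 → ConjClasses G) (_hC : ∀ i, ∀ x ∈ (C i).carrier, ¬ p ∣ orderOf x) :
    -- the product formula
    (∀ g ∈ nielsenClass p (MonoidHom.id G) C, IsOnlyCusp p g →
      ∃ (hG : IsPPerfect p G)
        (h14 : IsPPerfect p (H14 g))
        (h23 : IsPPerfect p (H23 g)),
        liftingInvariant p (repCover p G hG).proj g =
          repCoverMap p (H14 g) h14 hG
            (liftingInvariant p
              (repCover p (H14 g) h14).proj (triple14 g)) *
          repCoverMap p (H23 g) h23 hG
            (liftingInvariant p
              (repCover p (H23 g) h23).proj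
              (triple23 g))) ∧
    -- lifting from level `k` to level `k + 1`
    (∀ k, ∀ g ∈ nielsenClass p (tower p G k).proj C,
      IsOnlyCusp p g →
      liftingInvariant p (headCover p (H23 g)).proj
        (triple23 g) = 1 →
      liftingInvariant p (headCover p (H14 g)).proj
        (triple14 g) = 1 →
      ∃ g' ∈ nielsenClass p (tower p G (k + 1)).proj C,
        IsOnlyCusp p g' ∧ ∀ i, step p G k (g' i) = g i) ∧
    -- infinite branches
    (∀ g ∈ nielsenClass p (MonoidHom.id G) C, IsOnlyCusp p g →
      (∃ O : ∀ k, Set (Fin 3 → tower p (H23 g) k),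
        IsComponentBranch p
          (classesOf (triple23 g)) O ∧
        StartsAt p O (triple23 g)) →
      (∃ O : ∀ k, Set (Fin 3 → tower p (H14 g) k),
        IsComponentBranch p
          (classesOf (triple14 g)) O ∧
        StartsAt p O (triple14 g)) →
      ∃ b : ∀ k, Fin 4 → tower p G k,
        (∀ i, (tower p G 0).proj (b 0 i) = g i) ∧
        (∀ k i, step p G k (b (k + 1) i) = b k i) ∧
        (∀ k, b k ∈ nielsenClass p (tower p G k).proj C ∧
          IsOnlyCusp p (b k)) ∧
        IsCuspBranch p C (fun k => cuspSet (b k)) ∧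
        IsComponentBranch p C (fun k => braidOrbit (b k)) ∧
        StartsAt p (fun k => braidOrbit (b k)) g) := by
  refine ⟨fun g hg ho => liftingInvariant_eq_mul hg ho,
    fun k g hg ho h23 h14 => exists_lift_of_liftingInvariant hg ho h23 h14, ?_⟩
  rintro g hg ho ⟨O, hO, hO0⟩ ⟨O', hO', hO0'⟩
  obtain ⟨b, hb0, hb, hbN⟩ := exists_tower_of_hasTowerLift hg ho
    ((hasTowerLift_of_isComponentBranch hO hO0).1.map (H23 g).subtype)
    ((hasTowerLift_of_isComponentBranch hO' hO0').2.map (H14 g).subtype)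
  have hb' : ∀ k, (fun i => step p G k (b (k + 1) i)) = b k := fun k => funext (hb k)
  refine ⟨b, hb0, hb, hbN, ⟨fun k => ⟨b k, (hbN k).1, rfl⟩, fun k => ?_⟩,
    ⟨fun k => ⟨b k, (hbN k).1, rfl⟩, fun k => ?_⟩, ?_⟩
  · have := mapsTo_cuspSet (step p G k) (b (k + 1))
    rwa [hb' k] at this
  · have := mapsTo_braidOrbit (step p G k) (b (k + 1))
    rwa [hb' k] at this
  · have h0 : b 0 = g := funext hb0
    change id '' braidOrbit (b 0) = braidOrbit g
    rw [Set.image_id, h0]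
    rfl
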